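/- Throughout, $\log=\log_2$. There are absolute constants $b>0$ and $c_2\ge c_1>0$ such that the following holds. Let $(V,d)$ be a finite metric space with $n$ points, in which distinct points have distance at least $1$, with diameter $\Delta\ge 2$ and doubling dimension $\kappa$ (the least $\kappa\ge 0$ such that every ball of radius $2\rho$, $\rho>0$, is covered by at most $2^{\kappa}$ balls of radius $\rho$). Let $0<\varepsilon\le 1$, let $a\ge1$ be an integer, and put $\delta=\log\Delta$, $\kappa_1=c_1\kappa$, $\kappa'=c_2\kappa$, $\beta=\varepsilon/(4\kappa_1\delta)$, $\gamma=\lceil 3\log n\rceil$. Write $\Delta_U$ for the diameter of $U\subseteq V$. A $\rho$-net of $U$ is a set $N\subseteq U$ whose distinct points are at distance at least $\rho$ and such that each point of $U$ is within distance $\rho$ of $N$. A split of a set (cluster) $C\subseteq V$ is a partition $\pi$ of $C$ into at most $2^{b\kappa}$ non-empty clusters of diameter at most $\Delta_C/2$, together with a $\beta\Delta_D$-net (the set of portals) of each part $D$. Its set $R_\pi$ of bridge-edges consists of the edges joining different parts, and its set $R'_\pi$ of portal-edges of the edges joining portals of different parts. A $\gamma$-split-tree is a rooted tree with alternating levels of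 cluster nodes and split nodes: the root is the cluster $V$; a cluster node $C$ is a leaf if $|C|\le a$, and otherwise has $\gamma$ split nodes as children, each carrying a split of $C$; the children of a split node are the parts of its split. A determining function $\Phi$ for a $\gamma$-split-tree $\Gamma$ is a partial function that maps cluster nodes to split node children of theirs and is defined at the root (if the root is not a leaf) and at each non-leaf cluster node all of whose ancestor split nodes are values of $\Phi$. The induced decomposition $T=\Gamma|_\Phi$ consists of the cluster nodes all of whose ancestor split nodes are values of $\Phi$; the partition of a non-leaf cluster $C\in T$ is the one at the split node $\Phi(C)$, written $\pi_{\Phi(C)}$. Walks are walks in the complete graph on $V$ weighted by $d$. For a walk $P$, $\|P\|$ is its length (with multiplicity), $\|P\cap C\|$ is the total length of those of its steps that have both ends in $C$, and $|P\cap R|$ is the number of different edges of $P$ in the set of edges $R$. For $s,t\in V$ and an integer $k\ge0$, an optimum solution of $k$-stroll is an $s$-$t$ walk of minimum length among those that visit at least $k$ different vertices. Then for each $C\subseteq V$ with $|C|>a$ there is a probability distribution $\nu_C$ on splits of $C$, under which any $u,v\in C$ lie in different parts with probability at most $\kappa_1 d(u,v)/\Delta_C$, such that the random $\gamma$-split-tree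 $\Gamma$, in which the $\gamma$ splits at each non-leaf cluster node $C$ are drawn from $\nu_C$, all draws being independent, has the following property. For all $s,t,k$ and each optimum solution $P^*$ of $k$-stroll, with probability at least $1-1/n$ there is a determining function $\Phi$ for $\Gamma$, with $T=\Gamma|_\Phi$, such that: (a) There is an $s$-$t$ walk $P'$ that visits at least $k$ vertices, with $\|P'\|\le(1+\varepsilon)\|P^*\|$, such that for every non-leaf cluster $C\in T$ either 1) $|P'\cap R_{\pi_{\Phi(C)}}|\le 2\kappa'\frac{\log n}{\varepsilon}$, or 2) $|P'\cap R'_{\pi_{\Phi(C)}}|\le\left(\frac{16\kappa'\delta}{\varepsilon}\right)^{2\kappa}$ and $\|P'\cap C\|\le(1+\varepsilon)\|P^*\cap C\|$. (b) There are an $s$-$t$ walk $P'$ that visits at least $k$ vertices, with $\|P'\|\le(1+\varepsilon)\|P^*\|$, and a set $\mathcal D$ of cluster nodes, such that: for every non-leaf $C\in T$ with $C\notin\mathcal D$, $|P'\cap R_{\pi_{\Phi(C)}}|\le 2\kappa'\frac{\log n}{\varepsilon}$; for every non-leaf $C\in T$ with $C\in\mathcal D$, all edges of $P'$ in $R_{\pi_{\Phi(C)}}$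 lie in $R'_{\pi_{\Phi(C)}}$ ($P'$ is portal-respecting at $C$) and $|P'\cap R'_{\pi_{\Phi(C)}}|\le\left(\frac{16\kappa'\delta}{\varepsilon}\right)^{2\kappa}$; and $\|P'\cap C\|\le(1+\varepsilon)\|P^*\cap C\|$ for every $C\in T$ that has no proper ancestor in $\mathcal D$. -/

import Mathlib

open MeasureTheory

/-- `κ` is the doubling dimension of `V`: the least `κ ≥ 0` such that every ball of radius `2ρ`
is covered by at most `2 ^ κ` balls of radius `ρ`. -/
def IsDoublingDim (V : Type*) [MetricSpace V] (κ : ℝ) : Prop :=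
  IsLeast {x : ℝ | 0 ≤ x ∧ ∀ (v : V) (ρ : ℝ), 0 < ρ → ∃ S : Finset V, (S.card : ℝ) ≤ 2 ^ x ∧
    Metric.closedBall v (2 * ρ) ⊆ ⋃ z ∈ S, Metric.closedBall z ρ} κ

/-- `N` is a `ρ`-net of `U`: a `ρ / 2`-packing (distinct points are at distance at least `ρ`)
inside `U` which is a `ρ`-cover of `U`. -/
def IsNet {V : Type*} [MetricSpace V] (ρ : ℝ) (N U : Finset V) : Prop :=
  N ⊆ U ∧ (∀ u ∈ N, ∀ v ∈ N, u ≠ v → ρ ≤ dist u v) ∧ ∀ u ∈ U, ∃ c ∈ N, dist u c ≤ ρ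

/-! ### Walks in the complete graph on `V`, weighted by the metric -/

/-- A walk from `s` to `t` in the complete graph on `V`. -/
abbrev KWalk (V : Type*) (s t : V) : Type _ := (⊤ : SimpleGraph V).Walk s t

namespace KWalk

variable {V : Type*} {s t : V}

/-- The length `‖P‖` (every traversal of an edge counts). -/
noncomputable def len [MetricSpace V] (P : KWalk V s t) : ℝ :=
  (P.darts.map fun e => dist e.fst e.snd).sum

/-- The length `‖P ∩ C‖` of the restriction of `P` to `C`, that is, of the traversals of edges
with both ends in `C`. -/
noncomputable def lenIn [MetricSpace V] [DecidableEq V] (P : KWalk V s t) (C : Finset V) : ℝ :=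
  ((P.darts.filter fun e => e.fst ∈ C ∧ e.snd ∈ C).map fun e => dist e.fst e.snd).sum

/-- The number `|P|` of distinct vertices on `P`. -/
def numVisited [DecidableEq V] (P : KWalk V s t) : ℕ := P.support.toFinset.card

/-- The number `|P ∩ R|` of edges of `P` that belong to the set of edges `R`. -/
noncomputable def numEdgesIn (P : KWalk V s t) (R : Set (Sym2 V)) : ℕ :=
  Set.ncard {e | e ∈ P.edges ∧ e ∈ R}

/-- `P` is an optimum solution of the `k`-stroll instance with start `s` and end `t`. -/
def IsOptimal [MetricSpace V] [DecidableEq V] (k : ℕ) (P : KWalk V s t) : Prop :=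
  k ≤ P.numVisited ∧ ∀ Q : KWalk V s t, k ≤ Q.numVisited → P.len ≤ Q.len

end KWalk

/-! ### Partitions with portals -/

/-- The data of a split node: the parts of a partition of a cluster and, for every part, a set of
portals (the values of `portals` at other sets are irrelevant). -/
structure Split (V : Type*) where
  parts : Finset (Finset V)
  portals : Finset V → Finset V

instance (V : Type*) : MeasurableSpace (Split V) := ⊤

namespace Split

variable {V : Type*}

/-- The bridge-edges: edges whose ends lie in different parts. -/
def bridgeEdges (π : Split V) : Set (Sym2 V) :=
  {e | ∃ A ∈ π.parts, ∃ B ∈ π.parts, A ≠ B ∧ ∃ u ∈ A, ∃ v ∈ B, e = s(u, v)}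

/-- The portal-edges: edges whose ends are portals of different parts. -/
def portalEdges (π : Split V) : Set (Sym2 V) :=
  {e | ∃ A ∈ π.parts, ∃ B ∈ π.parts, A ≠ B ∧
    ∃ u ∈ π.portals A, ∃ v ∈ π.portals B, e = s(u, v)}

/-- `π` partitions `C` into at most `m` non-empty clusters of diameter at most half the diameter
of `C`, and the portals of each part `D` are a `β * diam D`-net of `D`. -/
def IsSplitOf [MetricSpace V] (m β : ℝ) (C : Finset V) (π : Split V) : Prop :=
  (∀ D ∈ π.parts, D.Nonempty ∧ D ⊆ C) ∧
  (∀ u ∈ C, ∃! D, D ∈ π.parts ∧ u ∈ D) ∧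
  (π.parts.card : ℝ) ≤ m ∧
  (∀ D ∈ π.parts, Metric.diam (D : Set V) ≤ Metric.diam (C : Set V) / 2) ∧
  ∀ D ∈ π.parts, IsNet (β * Metric.diam (D : Set V)) (π.portals D) D

end Split

/-- `ν` is the law of a random split of the cluster `C`, with parameters `m` and `β`, for which
`u, v ∈ C` are separated with probability at most `κ₁ * d(u, v) / diam C`. -/
def IsRandomSplit {V : Type*} [MetricSpace V] (m β κ₁ : ℝ) (C : Finset V)
    (ν : PMF (Split V)) : Prop :=
  (∀ π ∈ ν.support, π.IsSplitOf m β C) ∧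
  ∀ u ∈ C, ∀ v ∈ C, ν.toMeasure {π | s(u, v) ∈ π.bridgeEdges} ≤
    ENNReal.ofReal (κ₁ * dist u v / Metric.diam (C : Set V))

/-! ### `γ`-split-trees -/

/-- The address of a cluster node: the steps from the root down to the node, the last step first.
A step `(i, D)` goes from a cluster node to its `i`-th split node and from there to the cluster
node of the part `D`. -/
abbrev Addr (V : Type*) (γ : ℕ) : Type _ := List (Fin γ × Finset V)

/-- The cluster of a cluster node; the root has the cluster `V`. -/
def Addr.cluster {V : Type*} [Fintype V] {γ : ℕ} : Addr V γ → Finset V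
  | [] => Finset.univ
  | (_, D) :: _ => D

/-- The data of a `γ`-split-tree: `Γ (p, i)` is the split at the `i`-th split node child of the
cluster node `p`. Only the values at the non-leaf cluster nodes of the tree are relevant. -/
abbrev SplitTree (V : Type*) (γ : ℕ) : Type _ := Addr V γ × Fin γ → Split V

namespace SplitTree

variable {V : Type*} [Fintype V] {γ : ℕ}

/-- `p` is a cluster node of `Γ`; the leaves are the cluster nodes with at most `a` points. -/
inductive IsNode (a : ℕ) (Γ : SplitTree V γ) : Addr V γ → Prop
  | root : IsNode a Γ []
  | step {p : Addr V γ} {i : Fin γ} {D : Finset V} : IsNode a Γ p → a < p.cluster.card →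
      D ∈ (Γ (p, i)).parts → IsNode a Γ ((i, D) :: p)

/-- `Γ` is a `γ`-split-tree. -/
def IsSplitTree [MetricSpace V] (a : ℕ) (m β : ℝ) (Γ : SplitTree V γ) : Prop :=
  ∀ p : Addr V γ, IsNode a Γ p → a < p.cluster.card →
    ∀ i : Fin γ, (Γ (p, i)).IsSplitOf m β p.cluster

/-- `p` is a node of the decomposition induced by the partial function `Φ`: all split nodes above
`p` are values of `Φ` (at the cluster nodes above `p`). -/
inductive IsInducedNode (a : ℕ) (Γ : SplitTree V γ) (Φ : Addr V γ → Option (Fin γ)) :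
    Addr V γ → Prop
  | root : IsInducedNode a Γ Φ []
  | step {p : Addr V γ} {i : Fin γ} {D : Finset V} : IsInducedNode a Γ Φ p →
      a < p.cluster.card → Φ p = some i → D ∈ (Γ (p, i)).parts →
      IsInducedNode a Γ Φ ((i, D) :: p)

/-- `Φ` is a determining function for `Γ`: it is defined at the root, and at every non-leaf cluster
node all of whose ancestor split nodes are values of `Φ`. -/
def IsDetermining (a : ℕ) (Γ : SplitTree V γ) (Φ : Addr V γ → Option (Fin γ)) : Prop :=
  ∀ p : Addr V γ, IsInducedNode a Γ Φ p → a < p.cluster.card → ∃ i, Φ p = some i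

/-- The law of the random `γ`-split-tree in which the `γ` splits at a cluster node with cluster `C`
are drawn from `ν C`, all draws at all cluster nodes being independent. -/
noncomputable def law (γ : ℕ) (ν : Finset V → PMF (Split V)) : Measure (SplitTree V γ) :=
  Measure.infinitePi fun x : Addr V γ × Fin γ => (ν x.1.cluster).toMeasure

variable [MetricSpace V] [DecidableEq V] {s t : V}

/-- For every non-leaf cluster `C` of the induced decomposition, with the partition chosen by `Φ`:
either `P'` has at most `N₁` bridge-edges, or it has at most `N₂` portal-edges and
`‖P' ∩ C‖ ≤ (1 + ε) ‖P ∩ C‖`. -/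
def FewEdges (a : ℕ) (Γ : SplitTree V γ) (Φ : Addr V γ → Option (Fin γ)) (ε N₁ N₂ : ℝ)
    (P P' : KWalk V s t) : Prop :=
  ∀ p : Addr V γ, IsInducedNode a Γ Φ p → a < p.cluster.card → ∀ i, Φ p = some i →
    (P'.numEdgesIn (Γ (p, i)).bridgeEdges : ℝ) ≤ N₁ ∨
    ((P'.numEdgesIn (Γ (p, i)).portalEdges : ℝ) ≤ N₂ ∧
      P'.lenIn p.cluster ≤ (1 + ε) * P.lenIn p.cluster)

/-- `P'` is portal-respecting along the induced decomposition: there is a set `𝒟` of cluster nodes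
such that `P'` has at most `N₁` bridge-edges at a non-leaf cluster outside `𝒟`, whereas at a
non-leaf cluster in `𝒟` all bridge-edges of `P'` are portal-edges and there are at most `N₂` of
them; and `‖P' ∩ C‖ ≤ (1 + ε) ‖P ∩ C‖` for every cluster `C` of the induced decomposition that has
no proper ancestor in `𝒟`. -/
def PortalRespecting (a : ℕ) (Γ : SplitTree V γ) (Φ : Addr V γ → Option (Fin γ)) (ε N₁ N₂ : ℝ)
    (P P' : KWalk V s t) : Prop :=
  ∃ 𝒟 : Set (Addr V γ),
    (∀ p : Addr V γ, IsInducedNode a Γ Φ p → a < p.cluster.card → ∀ i, Φ p = some i →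
      (p ∉ 𝒟 → (P'.numEdgesIn (Γ (p, i)).bridgeEdges : ℝ) ≤ N₁) ∧
      (p ∈ 𝒟 → (∀ e ∈ P'.edges, e ∈ (Γ (p, i)).bridgeEdges → e ∈ (Γ (p, i)).portalEdges) ∧
        (P'.numEdgesIn (Γ (p, i)).portalEdges : ℝ) ≤ N₂)) ∧
    ∀ p : Addr V γ, IsInducedNode a Γ Φ p → (∀ q ∈ 𝒟, q <:+ p → q = p) →
      P'.lenIn p.cluster ≤ (1 + ε) * P.lenIn p.cluster

end SplitTree

/-!
A cluster `C` is split by the random partition of Calinescu, Karloff and Rabani: `C` is covered by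
at most `2 ^ (3 κ)` balls of radius `diam C / 8`, these balls are inflated by a random common factor
between `1` and `2`, and every point goes to the first ball, in a random order, that contains it.
Ordering the centres by their distance to `{u, v}`, the `i`-th one separates `u` from `v` with
probability at most `9 d(u, v) / (i * diam C)`, and the harmonic sum over the centres is at most
`4 κ` (`IsDoublingDim.exists_isRandomSplit`). Portals are arbitrary nets, and packing bounds the
number of portals of a split, hence of its portal-edges
(`IsDoublingDim.ncard_portalEdges_le`).

The walk is rerouted from the root downwards. A node of the split-tree receives the list of those
edges of the current walk that lie inside its cluster (`SplitTree.edgesAt`). A split is good if it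
cuts at most twice as many of these edges as expected. If a good split has too many different
bridge-edges, every bridge-edge takes the detour through the nearby portals of its two ends, which
multiplies the length inside the cluster by at most `1 + ε / (4 δ)`; otherwise nothing happens.
Since diameters are halved along the tree, this is repeated at most `⌊δ⌋ + 1` times, and the length
grows by a factor of at most `1 + ε` altogether. Rerouting below a node does not change the bridge-
edges at that node, so the final walk is portal-respecting, `𝒟` being the set of nodes where edges
have been rerouted (`SplitTree.exists_rerouting`, `SplitTree.exists_portalRespecting`). For the
first property of the theorem the optimum walk itself serves: the bound on the number of portal-
edges of a split applies to every walk.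

By Markov's inequality a random split is good with probability at least `1 / 2`. The node `p` and
the edges that it receives only depend on the splits at proper ancestors of `p`, so conditionally on
them all `γ` splits at `p` fail with probability at most `2 ^ (-γ) ≤ n ^ (-3)`
(`SplitTree.law_no_good_split_le`). As an induced decomposition has at most `n` levels, each with at
most `n` disjoint clusters, the expected number of nodes without a good split is at most `1 / n`
(`SplitTree.law_exists_no_good_split_le`).
-/

/-! ### Consequences of the doubling dimension -/

section Doubling

variable {V : Type*} [MetricSpace V] {κ : ℝ}

/-- Iterating the doubling property `j` times. -/
theorem IsDoublingDim.exists_cover (hκ : IsDoublingDim V κ) (j : ℕ) (v : V) {ρ : ℝ} (hρ : 0 < ρ) :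
    ∃ S : Finset V, (S.card : ℝ) ≤ 2 ^ (κ * j) ∧
      Metric.closedBall v ρ ⊆ ⋃ z ∈ S, Metric.closedBall z (ρ / 2 ^ j) := by
  classical
  induction j with
  | zero => exact ⟨{v}, by simp, by simp⟩
  | succ j ih =>
    obtain ⟨S, hS, hcov⟩ := ih
    choose T hT hTcov using fun z => hκ.1.2 z (ρ / 2 ^ (j + 1)) (by positivity)
    refine ⟨S.biUnion T, ?_, ?_⟩
    · have h1 : (((S.biUnion T).card : ℕ) : ℝ) ≤ ∑ z ∈ S, ((T z).card : ℝ) := by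
        exact_mod_cast Finset.card_biUnion_le
      have h2 : ∑ z ∈ S, ((T z).card : ℝ) ≤ S.card * 2 ^ κ := by
        simpa using Finset.sum_le_sum fun z (_ : z ∈ S) => hT z
      calc _ ≤ _ := h1
        _ ≤ _ := h2
        _ ≤ 2 ^ (κ * j) * 2 ^ κ := by gcongr
        _ = 2 ^ (κ * (j + 1 : ℕ)) := by
          rw [← Real.rpow_add (by norm_num)]; push_cast; ring_nf
    · intro u hu
      obtain ⟨z, hz, huz⟩ := Set.mem_iUnion₂.1 (hcov hu)
      have h3 : 2 * (ρ / 2 ^ (j + 1)) = ρ / 2 ^ j := by field_simp; ring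
      have h4 := hTcov z (h3 ▸ huz)
      obtain ⟨w, hw, huw⟩ := Set.mem_iUnion₂.1 h4
      exact Set.mem_iUnion₂.2 ⟨w, Finset.mem_biUnion.2 ⟨z, hz, hw⟩, huw⟩

/-- A ball whose radius is the smallest positive distance of a point contains two points which no
ball of half the radius around a point of the space has in common, so `2 ^ κ` is at least `2`. -/
theorem IsDoublingDim.one_le [Finite V] [Nontrivial V] (hκ : IsDoublingDim V κ) : 1 ≤ κ := by
  obtain ⟨⟨u, v⟩, huv, hmin⟩ := Set.exists_min_image {x : V × V | x.1 ≠ x.2}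
    (fun x => dist x.1 x.2) (Set.toFinite _)
    (by obtain ⟨x, y, h⟩ := exists_pair_ne V; exact ⟨(x, y), h⟩)
  simp only [Set.mem_ofPred_eq, Prod.forall] at huv hmin
  have hd : 0 < dist u v := dist_pos.2 huv
  obtain ⟨S, hS, hcov⟩ := hκ.1.2 u (dist u v / 2) (by positivity)
  have key : ∀ x, dist x u ≤ dist u v → x ∈ S := by
    intro x hx
    have : x ∈ Metric.closedBall u (2 * (dist u v / 2)) := by
      rw [Metric.mem_closedBall]; linarith
    obtain ⟨z, hz, hxz⟩ := Set.mem_iUnion₂.1 (hcov this)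
    rw [Metric.mem_closedBall] at hxz
    by_cases h : x = z
    · exact h ▸ hz
    · have := hmin x z h; linarith
  have h2 : 1 < S.card :=
    Finset.one_lt_card.2 ⟨u, key u (by simp), v, key v (by rw [dist_comm]), huv⟩
  have h3 : (2 : ℝ) ^ (1 : ℝ) ≤ 2 ^ κ := by
    rw [Real.rpow_one]; exact le_trans (by exact_mod_cast h2) hS
  exact (Real.rpow_le_rpow_left_iff (by norm_num)).1 h3

theorem dist_le_diam_finset {C : Finset V} {u v : V} (hu : u ∈ C) (hv : v ∈ C) :
    dist u v ≤ Metric.diam (C : Set V) :=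
  Metric.dist_le_diam_of_mem C.finite_toSet.isBounded hu hv

theorem one_le_diam (hd : ∀ u v : V, u ≠ v → 1 ≤ dist u v) {C : Finset V} (hC : 1 < C.card) :
    1 ≤ Metric.diam (C : Set V) := by
  obtain ⟨u, hu, v, hv, huv⟩ := Finset.one_lt_card.1 hC
  exact (hd u v huv).trans (dist_le_diam_finset hu hv)

theorem exists_isNet (ρ : ℝ) (hρ : 0 ≤ ρ) (U : Finset V) : ∃ N, IsNet ρ N U := by
  classical
  obtain ⟨N, hN, hmax⟩ := Finset.exists_max_image
    (U.powerset.filter fun N => ∀ u ∈ N, ∀ v ∈ N, u ≠ v → ρ ≤ dist u v) Finset.card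
    ⟨∅, by simp⟩
  simp only [Finset.mem_filter, Finset.mem_powerset] at hN hmax
  refine ⟨N, hN.1, hN.2, fun u hu => ?_⟩
  by_contra! hfar
  have huN : u ∉ N := fun h => by
    have := hfar u h
    rw [dist_self] at this
    linarith
  have := hmax (insert u N) ⟨Finset.insert_subset hu hN.1, ?_⟩
  · rw [Finset.card_insert_of_notMem huN] at this; omega
  · intro x hx y hy hxy
    rcases Finset.mem_insert.1 hx with rfl | hx' <;> rcases Finset.mem_insert.1 hy with rfl | hy'
    · exact absurd rfl hxy
    · exact (hfar y hy').le
    · rw [dist_comm]; exact (hfar x hx').le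
    · exact hN.2 x hx' y hy' hxy

/-- A `β * diam D`-net of `D` has at most `(4 / β) ^ κ` points: `D` is covered by so many balls of
radius less than `β * diam D / 2`, each of which contains at most one point of the net. -/
theorem IsDoublingDim.card_net_le (hκ : IsDoublingDim V κ) {β : ℝ} (hβ : 0 < β) (hβ2 : β ≤ 2)
    {N D : Finset V} (hN : IsNet (β * Metric.diam (D : Set V)) N D) :
    (N.card : ℝ) ≤ (4 / β) ^ κ := by
  have hκ0 : 0 ≤ κ := hκ.1.1
  have h4 : 1 ≤ 4 / β := by rw [le_div_iff₀ hβ]; linarith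
  rcases N.eq_empty_or_nonempty with rfl | ⟨c, hc⟩
  · simpa using Real.rpow_nonneg (by positivity) _
  rcases (Metric.diam_nonneg (s := (D : Set V))).eq_or_lt with h0 | hpos
  · have : N.card ≤ 1 := Finset.card_le_one.2 fun x hx y hy => by
      have := dist_le_diam_finset (hN.1 hx) (hN.1 hy)
      exact dist_le_zero.1 (by linarith)
    calc (N.card : ℝ) ≤ 1 := by exact_mod_cast this
      _ ≤ _ := Real.one_le_rpow h4 hκ0
  obtain ⟨j, hj1, hj2⟩ := exists_nat_pow_near (x := 2 / β) (y := (2 : ℝ))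
    (by rw [le_div_iff₀ hβ]; linarith) (by norm_num)
  obtain ⟨S, hS, hcov⟩ := hκ.exists_cover (j + 1) c hpos
  have hin : ∀ x ∈ N, ∃ z ∈ S, dist x z ≤ Metric.diam (D : Set V) / 2 ^ (j + 1) := by
    intro x hx
    have : x ∈ Metric.closedBall c (Metric.diam (D : Set V)) :=
      dist_le_diam_finset (hN.1 hx) (hN.1 hc)
    simpa using hcov this
  choose! f hf hfd using hin
  have hcard : N.card ≤ S.card := by
    refine Finset.card_le_card_of_injOn f hf fun x hx y hy hxy => ?_
    by_contra hne
    have h1 := hN.2.1 x hx y hy hne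
    have h2 := hfd x hx
    have h3 := hfd y hy
    rw [← hxy] at h3
    have h5 := dist_triangle_right x y (f x)
    have h6 : Metric.diam (D : Set V) / 2 ^ (j + 1) < β * Metric.diam (D : Set V) / 2 := by
      rw [div_lt_iff₀ (by positivity)]
      rw [div_lt_iff₀ hβ] at hj2
      nlinarith
    linarith
  calc (N.card : ℝ) ≤ S.card := by exact_mod_cast hcard
    _ ≤ _ := hS
    _ = (2 ^ (j + 1)) ^ κ := by
      rw [mul_comm, Real.rpow_mul (by norm_num), Real.rpow_natCast]
    _ ≤ (4 / β) ^ κ := by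
      refine Real.rpow_le_rpow (by positivity) ?_ hκ0
      have : 4 / β = 2 * (2 / β) := by ring
      rw [pow_succ]; linarith

end Doubling

/-! ### Random splits -/

open Finset in
/-- In a uniformly random order, a given element of `S` comes first in `S` with probability at most
`1 / |S|`. -/
theorem card_perm_first_mul_card_le {m : ℕ} (S : Finset (Fin m)) {z : Fin m} (hz : z ∈ S) :
    (univ.filter fun σ : Equiv.Perm (Fin m) => ∀ w ∈ S, σ z ≤ σ w).card * S.card ≤
      Fintype.card (Equiv.Perm (Fin m)) := by
  classical
  set F : Fin m → Finset (Equiv.Perm (Fin m)) := fun y => univ.filter fun σ => ∀ w ∈ S, σ y ≤ σ w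
  have hle : ∀ y ∈ S, (F z).card ≤ (F y).card := by
    intro y hy
    refine card_le_card_of_injOn (fun σ => σ * Equiv.swap z y) ?_
      fun σ _ τ _ h => mul_right_cancel h
    intro σ hσ
    simp only [F, mem_coe, mem_filter, mem_univ, true_and, Equiv.Perm.coe_mul,
      Function.comp_apply, Equiv.swap_apply_right] at hσ ⊢
    intro w hw
    apply hσ
    rw [Equiv.swap_apply_def]
    split_ifs <;> assumption
  have hdisj : (S : Set (Fin m)).PairwiseDisjoint F := by
    intro x hx y hy hxy
    refine disjoint_left.2 fun σ h1 h2 => hxy ?_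
    simp only [F, mem_filter, mem_univ, true_and] at h1 h2
    exact σ.injective (le_antisymm (h1 y hy) (h2 x hx))
  calc (F z).card * S.card = ∑ y ∈ S, (F z).card := by rw [sum_const, smul_eq_mul, mul_comm]
    _ ≤ ∑ y ∈ S, (F y).card := sum_le_sum hle
    _ = (S.biUnion F).card := (card_biUnion hdisj).symm
    _ ≤ _ := card_le_univ _

/-- Listing the elements of `s` by increasing values of `f`, the `i`-th summand is at most
`1 / i`. -/
theorem sum_inv_card_le_harmonic {ι : Type*} [DecidableEq ι] (s : Finset ι) (f : ι → ℝ) :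
    ∑ z ∈ s, ((s.filter fun w => f w ≤ f z).card : ℝ)⁻¹ ≤ (harmonic s.card : ℝ) := by
  induction s using Finset.induction_on_max_value f with
  | empty => simp
  | insert a s ha hmax ih =>
    rw [Finset.sum_insert ha, Finset.card_insert_of_notMem ha, harmonic_succ, add_comm]
    push_cast
    refine add_le_add (le_trans (Finset.sum_le_sum fun z hz => ?_) ih) (le_of_eq ?_)
    · have hpos : 0 < (s.filter fun w => f w ≤ f z).card :=
        Finset.card_pos.2 ⟨z, Finset.mem_filter.2 ⟨hz, le_rfl⟩⟩
      gcongr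
      exact Finset.subset_insert _ _
    · have : (insert a s).filter (fun w => f w ≤ f a) = insert a s := by
        refine Finset.filter_true_of_mem fun x hx => ?_
        rcases Finset.mem_insert.1 hx with rfl | hx
        · exact le_rfl
        · exact hmax x hx
      rw [this, Finset.card_insert_of_notMem ha]
      push_cast; rfl

/-- At most `(b - a) / h + 1` terms of the progression `c, c + h, c + 2h, …` lie in `[a, b)`. -/
theorem card_progression_le (M : ℕ) {c h a b : ℝ} (hh : 0 < h) (hab : a ≤ b) :
    (((Finset.univ : Finset (Fin M)).filter
      fun j : Fin M => a ≤ c + j * h ∧ c + j * h < b).card : ℝ) ≤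
      (b - a) / h + 1 := by
  have h1 : ((Finset.univ : Finset (Fin M)).filter
      fun j : Fin M => a ≤ c + j * h ∧ c + j * h < b).card ≤
      (Finset.Ico ⌈(a - c) / h⌉₊ ⌈(b - c) / h⌉₊).card := by
    refine Finset.card_le_card_of_injOn (fun j => (j : ℕ)) (fun j hj => ?_)
      (Fin.val_injective.injOn)
    simp only [Finset.coe_filter, Finset.mem_univ, true_and, Set.mem_ofPred_eq] at hj
    simp only [Finset.coe_Ico, Set.mem_Ico, Nat.ceil_le, Nat.lt_ceil]
    rw [div_le_iff₀ hh, lt_div_iff₀ hh]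
    constructor <;> linarith [hj.1, hj.2]
  rw [Nat.card_Ico] at h1
  have h2 : ((⌈(b - c) / h⌉₊ - ⌈(a - c) / h⌉₊ : ℕ) : ℝ) ≤ (b - a) / h + 1 := by
    have h3 : 0 ≤ (b - a) / h := div_nonneg (by linarith) hh.le
    have h6 : (b - c) / h - (a - c) / h = (b - a) / h := by ring
    rcases le_total ⌈(b - c) / h⌉₊ ⌈(a - c) / h⌉₊ with hle | hle
    · rw [Nat.sub_eq_zero_of_le hle]; push_cast; linarith
    · rw [Nat.cast_sub hle]
      have h4 := Nat.le_ceil ((a - c) / h)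
      rcases le_total ((b - c) / h) 0 with hneg | hpos
      · have := Nat.ceil_eq_zero.2 hneg
        rw [this]
        push_cast
        linarith [Nat.cast_nonneg (α := ℝ) ⌈(a - c) / h⌉₊]
      · have h5 := Nat.ceil_lt_add_one hpos
        linarith
  exact le_trans (by exact_mod_cast h1) h2

section Cell

variable {V : Type*} [MetricSpace V] {m : ℕ}

/-- The cell of the `i`-th centre: the points of `C` for which `z i` is the first centre, in the
order given by `σ`, at distance at most `r`. -/
noncomputable def cell (C : Finset V) (z : Fin m → V) (σ : Equiv.Perm (Fin m)) (r : ℝ)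
    (i : Fin m) : Finset V :=
  open Classical in
  C.filter fun u => dist u (z i) ≤ r ∧ ∀ w, dist u (z w) ≤ r → σ i ≤ σ w

theorem mem_cell {C : Finset V} {z : Fin m → V} {σ : Equiv.Perm (Fin m)} {r : ℝ} {i : Fin m}
    {u : V} : u ∈ cell C z σ r i ↔
      u ∈ C ∧ dist u (z i) ≤ r ∧ ∀ w, dist u (z w) ≤ r → σ i ≤ σ w := by
  classical
  simp [cell]

/-- The split of `C` into the non-empty cells; `net D` are the portals of the part `D`. -/
noncomputable def cellSplit (C : Finset V) (z : Fin m → V) (net : Finset V → Finset V)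
    (σ : Equiv.Perm (Fin m)) (r : ℝ) : Split V :=
  open Classical in
  { parts := (Finset.univ.image (cell C z σ r)).filter Finset.Nonempty
    portals := net }

theorem mem_cellSplit_parts {C : Finset V} {z : Fin m → V} {net : Finset V → Finset V}
    {σ : Equiv.Perm (Fin m)} {r : ℝ} {D : Finset V} :
    D ∈ (cellSplit C z net σ r).parts ↔ (∃ i, cell C z σ r i = D) ∧ D.Nonempty := by
  classical
  simp [cellSplit]

theorem exists_mem_cell {C : Finset V} {z : Fin m → V} {σ : Equiv.Perm (Fin m)} {r : ℝ} {u : V}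
    (hu : u ∈ C) (hcov : ∃ i, dist u (z i) ≤ r) : ∃ i, u ∈ cell C z σ r i := by
  classical
  obtain ⟨i, hi, hmin⟩ := Finset.exists_min_image
    (Finset.univ.filter fun i => dist u (z i) ≤ r) σ (by simpa [Finset.Nonempty] using hcov)
  simp only [Finset.mem_filter, Finset.mem_univ, true_and] at hi hmin
  exact ⟨i, mem_cell.2 ⟨hu, hi, hmin⟩⟩

theorem cell_index_unique {C : Finset V} {z : Fin m → V} {σ : Equiv.Perm (Fin m)} {r : ℝ}
    {u : V} {i j : Fin m} (hi : u ∈ cell C z σ r i) (hj : u ∈ cell C z σ r j) : i = j := by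
  rw [mem_cell] at hi hj
  exact σ.injective (le_antisymm (hi.2.2 j hj.2.1) (hj.2.2 i hi.2.1))

theorem cellSplit_isSplitOf {C : Finset V} {z : Fin m → V} {net : Finset V → Finset V}
    {σ : Equiv.Perm (Fin m)} {r M β : ℝ} (hcov : ∀ u ∈ C, ∃ i, dist u (z i) ≤ r) (hm : m ≤ M)
    (hr : r ≤ Metric.diam (C : Set V) / 4)
    (hnet : ∀ D : Finset V, IsNet (β * Metric.diam (D : Set V)) (net D) D) :
    (cellSplit C z net σ r).IsSplitOf M β C := by
  classical
  refine ⟨fun D hD => ?_, fun u hu => ?_, ?_, fun D hD => ?_, fun D _ => hnet D⟩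
  · obtain ⟨⟨i, rfl⟩, hne⟩ := mem_cellSplit_parts.1 hD
    exact ⟨hne, fun u hu => (mem_cell.1 hu).1⟩
  · obtain ⟨i, hi⟩ := exists_mem_cell (σ := σ) hu (hcov u hu)
    refine ⟨cell C z σ r i, ⟨mem_cellSplit_parts.2 ⟨⟨i, rfl⟩, ⟨u, hi⟩⟩, hi⟩, ?_⟩
    rintro D ⟨hD, huD⟩
    obtain ⟨⟨j, rfl⟩, -⟩ := mem_cellSplit_parts.1 hD
    rw [cell_index_unique hi huD]
  · refine le_trans ?_ hm
    have : (cellSplit C z net σ r).parts.card ≤ m :=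
      (Finset.card_filter_le _ _).trans (Finset.card_image_le.trans (by simp))
    exact_mod_cast this
  · obtain ⟨⟨i, rfl⟩, u, hu⟩ := mem_cellSplit_parts.1 hD
    refine Metric.diam_le_of_forall_dist_le 
      (div_nonneg Metric.diam_nonneg (by norm_num)) fun x hx y hy => ?_
    have h1 := (mem_cell.1 hx).2.1
    have h2 := (mem_cell.1 hy).2.1
    have h3 := dist_triangle_right x y (z i)
    linarith

/-- If `u` and `v` are separated, then the first centre that reaches one of them reaches only one
of them. -/
theorem exists_cut_of_bridge {C : Finset V} {z : Fin m → V} {net : Finset V → Finset V}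
    {σ : Equiv.Perm (Fin m)} {r : ℝ} {u v : V}
    (h : s(u, v) ∈ (cellSplit C z net σ r).bridgeEdges) :
    ∃ i, (min (dist u (z i)) (dist v (z i)) ≤ r ∧ r < max (dist u (z i)) (dist v (z i))) ∧
      ∀ w, min (dist u (z w)) (dist v (z w)) ≤ r → σ i ≤ σ w := by
  -- the centres of the cells of `u` and `v` are distinct; the earlier one does not reach both
  have key : ∀ x y i j, i ≠ j → x ∈ cell C z σ r i → y ∈ cell C z σ r j → σ i ≤ σ j →
      (min (dist x (z i)) (dist y (z i)) ≤ r ∧ r < max (dist x (z i)) (dist y (z i))) ∧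
      ∀ w, min (dist x (z w)) (dist y (z w)) ≤ r → σ i ≤ σ w := by
    intro x y i j hij hx hy hle
    rw [mem_cell] at hx hy
    refine ⟨⟨min_le_of_left_le hx.2.1, lt_max_of_lt_right ?_⟩, fun w hw => ?_⟩
    · by_contra! hcon
      exact hij (σ.injective (le_antisymm hle (hy.2.2 i hcon)))
    · rcases min_le_iff.1 hw with h | h
      · exact hx.2.2 w h
      · exact hle.trans (hy.2.2 w h)
  obtain ⟨A, hA, B, hB, hAB, x, hx, y, hy, he⟩ := h
  obtain ⟨⟨i, rfl⟩, -⟩ := mem_cellSplit_parts.1 hA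
  obtain ⟨⟨j, rfl⟩, -⟩ := mem_cellSplit_parts.1 hB
  have hij : i ≠ j := fun h => hAB (by rw [h])
  have main : ∃ i, (min (dist x (z i)) (dist y (z i)) ≤ r ∧
      r < max (dist x (z i)) (dist y (z i))) ∧
      ∀ w, min (dist x (z w)) (dist y (z w)) ≤ r → σ i ≤ σ w := by
    rcases le_total (σ i) (σ j) with hle | hle
    · exact ⟨i, key x y i j hij hx hy hle⟩
    · refine ⟨j, ?_⟩
      have := key y x j i hij.symm hy hx hle
      simpa only [min_comm (dist y _), max_comm (dist y _)] using this
  rcases Sym2.eq_iff.1 he with ⟨rfl, rfl⟩ | ⟨rfl, rfl⟩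
  · exact main
  · simpa only [min_comm (dist v _), max_comm (dist v _)] using main

end Cell

section RandomSplit

variable {V : Type*} [MetricSpace V]

open Finset in
/-- The number of choices of an order `σ` of the centres and of a radius from the progression
`c, c + h, …` for which `u` and `v` are separated. A centre `z i` cuts the pair only if the radius
lies in an interval of length at most `d(u, v)` and `z i` precedes all centres which are closer to
`{u, v}`; these two events are independent. -/
theorem card_bridge_le {m M : ℕ} (C : Finset V) (z : Fin m → V) (net : Finset V → Finset V)
    {c h : ℝ} (hh : 0 < h) (u v : V) :
    letI := Classical.decPred fun x : Equiv.Perm (Fin m) × Fin M =>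
      s(u, v) ∈ (cellSplit C z net x.1 (c + x.2 * h)).bridgeEdges
    ((univ.filter fun x : Equiv.Perm (Fin m) × Fin M =>
      s(u, v) ∈ (cellSplit C z net x.1 (c + x.2 * h)).bridgeEdges).card : ℝ) ≤
      Fintype.card (Equiv.Perm (Fin m)) * ((dist u v / h + 1) * harmonic m) := by
  classical
  set a : Fin m → ℝ := fun i => min (dist u (z i)) (dist v (z i)) with ha
  set b : Fin m → ℝ := fun i => max (dist u (z i)) (dist v (z i)) with hb
  set S : Fin m → Finset (Fin m) := fun i => univ.filter fun w => a w ≤ a i with hS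
  set G : Fin m → Finset (Equiv.Perm (Fin m)) :=
    fun i => univ.filter fun σ => ∀ w ∈ S i, σ i ≤ σ w with hG
  set J : Fin m → Finset (Fin M) := fun i => univ.filter fun j : Fin M =>
    a i ≤ c + j * h ∧ c + j * h < b i with hJ
  have hsub : (univ.filter fun x : Equiv.Perm (Fin m) × Fin M =>
      s(u, v) ∈ (cellSplit C z net x.1 (c + x.2 * h)).bridgeEdges) ⊆
      univ.biUnion fun i => G i ×ˢ J i := by
    intro x hx
    obtain ⟨i, hi, hfirst⟩ := exists_cut_of_bridge (mem_filter.1 hx).2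
    refine mem_biUnion.2 ⟨i, mem_univ _, mem_product.2 ⟨?_, ?_⟩⟩
    · simp only [hG, hS, mem_filter, mem_univ, true_and]
      exact fun w hw => hfirst w (hw.trans hi.1)
    · simpa only [hJ, mem_filter, mem_univ, true_and] using hi
  have hab : ∀ i, a i ≤ b i := fun i => min_le_max
  have hba : ∀ i, b i - a i ≤ dist u v := by
    intro i
    rw [hb, ha]
    simp only [max_sub_min_eq_abs']
    exact abs_dist_sub_le _ _ _
  have hGi : ∀ i, ((G i).card : ℝ) ≤
      Fintype.card (Equiv.Perm (Fin m)) * ((S i).card : ℝ)⁻¹ := by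
    intro i
    have hmem : i ∈ S i := by simp [hS]
    have := card_perm_first_mul_card_le (S i) hmem
    have hpos : (0 : ℝ) < (S i).card := by exact_mod_cast card_pos.2 ⟨i, hmem⟩
    rw [← div_eq_mul_inv, le_div_iff₀ hpos]
    exact_mod_cast this
  have hJi : ∀ i, ((J i).card : ℝ) ≤ dist u v / h + 1 := fun i =>
    (card_progression_le M hh (hab i)).trans (by gcongr; exact hba i)
  have hd : 0 ≤ dist u v / h + 1 := by positivity
  calc _ ≤ ((univ.biUnion fun i => G i ×ˢ J i).card : ℝ) := by
        exact_mod_cast card_le_card hsub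
    _ ≤ ∑ i, ((G i ×ˢ J i).card : ℝ) := by exact_mod_cast card_biUnion_le
    _ ≤ ∑ i, Fintype.card (Equiv.Perm (Fin m)) * ((S i).card : ℝ)⁻¹ * (dist u v / h + 1) := by
        refine sum_le_sum fun i _ => ?_
        rw [card_product]; push_cast
        exact mul_le_mul (hGi i) (hJi i) (by positivity) (by positivity)
    _ = Fintype.card (Equiv.Perm (Fin m)) * ((dist u v / h + 1) * ∑ i, ((S i).card : ℝ)⁻¹) := by
        rw [mul_sum, mul_sum]
        exact sum_congr rfl fun i _ => by ring
    _ ≤ _ := by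
        have := sum_inv_card_le_harmonic (univ : Finset (Fin m)) a
        rw [card_univ, Fintype.card_fin] at this
        gcongr

theorem harmonic_le_of_le_rpow {m : ℕ} {κ : ℝ} (hκ : 1 ≤ κ) (hm0 : 0 < m)
    (hm : (m : ℝ) ≤ 2 ^ (3 * κ)) : (harmonic m : ℝ) ≤ 4 * κ := by
  have h1 := harmonic_le_one_add_log m
  have h2 : Real.log m ≤ 3 * κ * Real.log 2 := by
    rw [← Real.log_rpow (by norm_num)]
    exact Real.log_le_log (by exact_mod_cast hm0) hm
  have h3 := Real.log_two_lt_d9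
  nlinarith

/-- The random partition of Calinescu, Karloff and Rabani: balls around the points of a
`diam C / 8`-cover, taken in random order, with a random common radius between `diam C / 8` and
`diam C / 4`. -/
theorem IsDoublingDim.exists_isRandomSplit {κ β : ℝ} (hκ : IsDoublingDim V κ) (hκ1 : 1 ≤ κ)
    (hd : ∀ u v : V, u ≠ v → 1 ≤ dist u v) (hβ : 0 ≤ β) (C : Finset V) (hC : 1 < C.card) :
    ∃ ν : PMF (Split V), IsRandomSplit (2 ^ (3 * κ)) β (36 * κ) C ν := by
  classical
  set d := Metric.diam (C : Set V) with hdef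
  obtain ⟨u₀, hu₀⟩ := Finset.card_pos.1 (zero_lt_one.trans hC)
  have hd1 : 1 ≤ d := one_le_diam hd hC
  obtain ⟨S, hS, hcov⟩ := hκ.exists_cover 3 u₀ (ρ := d) (by linarith)
  set m := S.card
  set z : Fin m → V := fun i => (S.equivFin.symm i : V)
  have hz : ∀ u ∈ C, ∃ i, dist u (z i) ≤ d / 8 := by
    intro u hu
    have h1 : u ∈ Metric.closedBall u₀ d := dist_le_diam_finset hu hu₀
    obtain ⟨y, hy, huy⟩ := Set.mem_iUnion₂.1 (hcov h1)
    refine ⟨S.equivFin ⟨y, hy⟩, ?_⟩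
    simp only [z, Equiv.symm_apply_apply]
    rw [Metric.mem_closedBall] at huy
    norm_num at huy ⊢
    exact huy
  have hm : (m : ℝ) ≤ 2 ^ (3 * κ) := by
    refine hS.trans (le_of_eq ?_)
    push_cast; rw [mul_comm]
  have hm0 : 0 < m := by obtain ⟨i, -⟩ := hz u₀ hu₀; exact i.pos
  set M : ℕ := ⌈d⌉₊ with hM
  have hMd : d ≤ M := Nat.le_ceil d
  have hM0 : (0 : ℝ) < M := by linarith
  have : NeZero M := ⟨by intro h; rw [h] at hM0; simp at hM0⟩
  choose net hnet using fun D : Finset V => exists_isNet (β * Metric.diam (D : Set V))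
    (mul_nonneg hβ Metric.diam_nonneg) D
  set h : ℝ := d / 8 / M with hh
  have hh0 : 0 < h := by positivity
  set f : Equiv.Perm (Fin m) × Fin M → Split V :=
    fun x => cellSplit C z net x.1 (d / 8 + x.2 * h) with hf
  let _ : MeasurableSpace (Equiv.Perm (Fin m) × Fin M) := ⊤
  refine ⟨(PMF.uniformOfFintype _).map f, ?_, ?_⟩
  · intro π hπ
    obtain ⟨x, -, rfl⟩ := (PMF.mem_support_map_iff _ _ _).1 hπ
    refine cellSplit_isSplitOf (fun u hu => ?_) hm ?_ hnet
    · obtain ⟨i, hi⟩ := hz u hu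
      exact ⟨i, hi.trans (by nlinarith [Nat.cast_nonneg (α := ℝ) (x.2 : ℕ)])⟩
    · have h1 : ((x.2 : ℕ) : ℝ) ≤ M := by exact_mod_cast x.2.2.le
      have h2 : M * h = d / 8 := by rw [hh]; field_simp
      nlinarith
  · intro u hu v hv
    rw [PMF.toMeasure_map_apply _ _ _ measurable_from_top
      MeasurableSpace.measurableSet_top,
      PMF.toMeasure_uniformOfFintype_apply _ MeasurableSpace.measurableSet_top]
    have hcard := card_bridge_le (M := M) C z net (c := d / 8) hh0 u v
    have hdu : 0 ≤ dist u v := dist_nonneg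
    -- the discretisation of the radius costs `1 / M`, which is at most `d(u, v) / diam C`
    have hstep : (dist u v / h + 1) * harmonic m ≤ M * (36 * κ * dist u v / d) ∨ u = v := by
      by_cases huv : u = v
      · exact Or.inr huv
      left
      have h1 := hd u v huv
      have h2 : dist u v / h + 1 ≤ 9 * (M * dist u v / d) := by
        have h3 : dist u v / h = 8 * (M * dist u v / d) := by
          rw [hh]; field_simp
        have h4 : 1 ≤ M * dist u v / d := by
          rw [le_div_iff₀ (by linarith)]; nlinarith
        linarith
      have h5 := harmonic_le_of_le_rpow hκ1 hm0 hm
      calc (dist u v / h + 1) * harmonic m ≤ 9 * (M * dist u v / d) * (4 * κ) := by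
            refine mul_le_mul h2 h5 ?_ (by positivity)
            exact_mod_cast (harmonic_pos hm0.ne').le
        _ = _ := by ring
    rcases hstep with hstep | rfl
    · have h6 : ((Fintype.card ↑(f ⁻¹' {π | s(u, v) ∈ π.bridgeEdges}) : ℕ) : ℝ) ≤
          (Fintype.card (Equiv.Perm (Fin m) × Fin M) : ℕ) * (36 * κ * dist u v / d) := by
        rw [Fintype.card_prod, Fintype.card_fin]
        push_cast
        rw [mul_assoc]
        refine le_trans (le_of_eq ?_) (hcard.trans (by gcongr))
        rw [← Set.toFinset_card]
        congr 2
        ext x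
        simp [f]
      refine ENNReal.div_le_of_le_mul ?_
      rw [mul_comm, ← ENNReal.ofReal_natCast, ← ENNReal.ofReal_natCast,
        ← ENNReal.ofReal_mul (by positivity)]
      exact ENNReal.ofReal_le_ofReal h6
    · have h7 : f ⁻¹' {π | s(u, u) ∈ π.bridgeEdges} = ∅ := by
        ext x
        simp only [Set.mem_preimage, Set.mem_ofPred_eq, Set.mem_empty_iff_false, iff_false]
        intro hx
        obtain ⟨i, hi, -⟩ := exists_cut_of_bridge hx
        rw [min_self, max_self] at hi
        linarith [hi.1, hi.2]
      simp [h7]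

end RandomSplit

/-! ### Portals -/

section Portals

variable {V : Type*} [MetricSpace V]

/-- There are at most `2 ^ (3 κ) * (4 / β) ^ κ` portals, and a portal-edge is a pair of portals. -/
theorem IsDoublingDim.ncard_portalEdges_le {κ β : ℝ} (hκ : IsDoublingDim V κ) (hβ : 0 < β)
    (hβ2 : β ≤ 2) {C : Finset V} {π : Split V} (hπ : π.IsSplitOf (2 ^ (3 * κ)) β C) :
    (π.portalEdges.ncard : ℝ) ≤ (2 ^ (3 * κ) * (4 / β) ^ κ) ^ 2 ∧ π.portalEdges.Finite := by
  classical
  set U := π.parts.biUnion π.portals with hU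
  have hsub : π.portalEdges ⊆ ((U ×ˢ U).image fun x => s(x.1, x.2) : Finset (Sym2 V)) := by
    rintro e ⟨A, hA, B, hB, -, u, hu, v, hv, rfl⟩
    simp only [Finset.coe_image, Set.mem_image, Finset.mem_coe, Finset.mem_product]
    exact ⟨(u, v), ⟨Finset.mem_biUnion.2 ⟨A, hA, hu⟩, Finset.mem_biUnion.2 ⟨B, hB, hv⟩⟩, rfl⟩
  refine ⟨?_, (Finset.finite_toSet _).subset hsub⟩
  have h1 : π.portalEdges.ncard ≤ U.card * U.card := by
    refine (Set.ncard_le_ncard hsub (Finset.finite_toSet _)).trans ?_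
    rw [Set.ncard_coe_finset, ← Finset.card_product]
    exact Finset.card_image_le
  have h2 : (U.card : ℝ) ≤ 2 ^ (3 * κ) * (4 / β) ^ κ := by
    calc (U.card : ℝ) ≤ ∑ D ∈ π.parts, ((π.portals D).card : ℝ) := by
          exact_mod_cast Finset.card_biUnion_le
      _ ≤ ∑ D ∈ π.parts, (4 / β) ^ κ :=
          Finset.sum_le_sum fun D hD => hκ.card_net_le hβ hβ2 (hπ.2.2.2.2 D hD)
      _ ≤ _ := by
          rw [Finset.sum_const, nsmul_eq_mul]
          gcongr
          exact hπ.2.2.1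
  calc (π.portalEdges.ncard : ℝ) ≤ U.card * U.card := by exact_mod_cast h1
    _ ≤ _ := by rw [sq]; gcongr

end Portals

theorem KWalk.numEdgesIn_le {V : Type*} {s t : V} (P : KWalk V s t) {R : Set (Sym2 V)}
    (hR : R.Finite) :
    P.numEdgesIn R ≤ R.ncard :=
  Set.ncard_le_ncard (fun _ h => h.2) hR

/-! ### Walks as lists of edges -/

section Lists

variable {V : Type*}

/-- The list `L` of directed edges, loops allowed, is a walk from `u` to `v`. -/
def Joins : V → List (V × V) → V → Prop
  | u, [], v => u = v
  | u, e :: L, v => e.1 = u ∧ Joins e.2 L v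

theorem Joins.append {u v w : V} {L M : List (V × V)} (hL : Joins u L v) (hM : Joins v M w) :
    Joins u (L ++ M) w := by
  induction L generalizing u with
  | nil => cases hL; exact hM
  | cons e L ih => exact ⟨hL.1, ih hL.2⟩

theorem Joins.flatMap {u v : V} {L : List (V × V)} (hL : Joins u L v)
    {σ : V × V → List (V × V)} (hσ : ∀ e ∈ L, Joins e.1 (σ e) e.2) :
    Joins u (L.flatMap σ) v := by
  induction L generalizing u with
  | nil => exact hL
  | cons e L ih =>
    rw [List.flatMap_cons]
    have h1 := hσ e List.mem_cons_self
    rw [hL.1] at h1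
    exact h1.append (ih hL.2 fun f hf => hσ f (List.mem_cons_of_mem _ hf))

theorem Joins.exists_mem_snd {u v : V} {L : List (V × V)} (hL : Joins u L v) (huv : u ≠ v) :
    ∃ f ∈ L, f.1 ≠ f.2 ∧ f.2 = v := by
  induction L generalizing u with
  | nil => exact absurd hL huv
  | cons e L ih =>
    by_cases h : e.2 = v
    · refine ⟨e, List.mem_cons_self, ?_, h⟩
      rw [hL.1, h]; exact huv
    · obtain ⟨f, hf, h1⟩ := ih hL.2 h
      exact ⟨f, List.mem_cons_of_mem _ hf, h1⟩

/-- The edges of a walk, as ordered pairs. -/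
def KWalk.pairs {s t : V} (P : KWalk V s t) : List (V × V) :=
  P.darts.map fun e => (e.fst, e.snd)

theorem KWalk.joins_pairs {s t : V} (P : KWalk V s t) : Joins s P.pairs t := by
  induction P with
  | nil => rfl
  | cons h P ih => exact ⟨rfl, ih⟩

theorem KWalk.ne_of_mem_pairs {s t : V} (P : KWalk V s t) {e : V × V} (he : e ∈ P.pairs) :
    e.1 ≠ e.2 := by
  obtain ⟨d, -, rfl⟩ := List.mem_map.1 he
  exact d.adj

/-- Removing the loops turns a list of edges into a walk in the complete graph. -/
theorem Joins.exists_walk [DecidableEq V] {s t : V} {L : List (V × V)} (hL : Joins s L t) :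
    ∃ P : KWalk V s t, P.pairs = L.filter fun e => e.1 ≠ e.2 := by
  induction L generalizing s with
  | nil => cases hL; exact ⟨SimpleGraph.Walk.nil, rfl⟩
  | cons e L ih =>
    obtain ⟨P, hP⟩ := ih hL.2
    obtain ⟨u, v⟩ := e
    obtain ⟨rfl, -⟩ := hL
    by_cases h : u = v
    · subst h
      exact ⟨P, by rw [hP]; simp⟩
    · refine ⟨SimpleGraph.Walk.cons (show (⊤ : SimpleGraph V).Adj u v from h) P, ?_⟩
      simp only [KWalk.pairs, SimpleGraph.Walk.darts_cons, List.map_cons] at hP ⊢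
      rw [hP]; simp [h]

theorem KWalk.mem_support_iff {s t : V} (P : KWalk V s t) {w : V} :
    w ∈ P.support ↔ w = s ∨ ∃ e ∈ P.pairs, e.2 = w := by
  rw [← SimpleGraph.Walk.cons_map_snd_darts, List.mem_cons]
  simp [KWalk.pairs]

theorem KWalk.mem_edges_iff {s t : V} (P : KWalk V s t) {x : Sym2 V} :
    x ∈ P.edges ↔ ∃ e ∈ P.pairs, s(e.1, e.2) = x := by
  simp only [SimpleGraph.Walk.edges, KWalk.pairs, List.mem_map, exists_exists_and_eq_and]
  rfl

/-- The edges of `L` with both ends in `C`. -/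
def inside [DecidableEq V] (C : Finset V) (L : List (V × V)) : List (V × V) :=
  L.filter fun e => e.1 ∈ C ∧ e.2 ∈ C

theorem mem_inside [DecidableEq V] {C : Finset V} {L : List (V × V)} {e : V × V} :
    e ∈ inside C L ↔ e ∈ L ∧ e.1 ∈ C ∧ e.2 ∈ C := by
  simp [inside]

theorem inside_eq_self [DecidableEq V] {C : Finset V} {L : List (V × V)}
    (h : ∀ e ∈ L, e.1 ∈ C ∧ e.2 ∈ C) : inside C L = L :=
  List.filter_eq_self.2 fun e he => by simpa using h e he

theorem inside_inside [DecidableEq V] {C D : Finset V} (h : D ⊆ C) (L : List (V × V)) :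
    inside D (inside C L) = inside D L := by
  rw [inside, inside, List.filter_filter]
  refine List.filter_congr fun e _ => ?_
  rw [← Bool.decide_and]
  exact decide_eq_decide.2 ⟨fun h' => h'.1, fun h' => ⟨h', h h'.1, h h'.2⟩⟩

variable [MetricSpace V]

/-- The total length of a list of edges. -/
noncomputable def totalLen (L : List (V × V)) : ℝ := (L.map fun e => dist e.1 e.2).sum

@[simp]
theorem totalLen_nil : totalLen ([] : List (V × V)) = 0 := rfl

@[simp]
theorem totalLen_cons (e : V × V) (L : List (V × V)) :
    totalLen (e :: L) = dist e.1 e.2 + totalLen L := by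
  simp [totalLen]

theorem totalLen_append (L M : List (V × V)) : totalLen (L ++ M) = totalLen L + totalLen M := by
  simp [totalLen]

theorem totalLen_nonneg (L : List (V × V)) : 0 ≤ totalLen L :=
  List.sum_nonneg fun x hx => by
    obtain ⟨e, -, rfl⟩ := List.mem_map.1 hx
    exact dist_nonneg

theorem totalLen_inside_filter_ne [DecidableEq V] (C : Finset V) (L : List (V × V)) :
    totalLen (inside C (L.filter fun e => e.1 ≠ e.2)) = totalLen (inside C L) := by
  induction L with
  | nil => rfl
  | cons e L ih =>
    simp only [inside, List.filter_cons] at ih ⊢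
    by_cases h : e.1 = e.2
    · split_ifs with h1 h2 h2 <;> simp_all
    · simp only [ne_eq, h, not_false_eq_true, decide_true, if_true, List.filter_cons]
      split_ifs <;> simp_all

theorem KWalk.lenIn_eq [DecidableEq V] {s t : V} (P : KWalk V s t) (C : Finset V) :
    P.lenIn C = totalLen (inside C P.pairs) := by
  simp only [KWalk.lenIn, totalLen, inside, KWalk.pairs, List.filter_map, List.map_map]
  rfl

theorem KWalk.len_eq {s t : V} (P : KWalk V s t) : P.len = totalLen P.pairs := by
  simp only [KWalk.len, totalLen, KWalk.pairs, List.map_map]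
  rfl

end Lists

/-! ### Edges of a list relative to a split -/

namespace Split

variable {V : Type*}

/-- The number of different bridge-edges in `L`. -/
noncomputable def numBridges (π : Split V) (L : List (V × V)) : ℕ :=
  Set.ncard {x | (∃ e ∈ L, s(e.1, e.2) = x) ∧ x ∈ π.bridgeEdges}

/-- The sublist of the bridge-edges of `L`, with multiplicity. -/
noncomputable def bridges (π : Split V) (L : List (V × V)) : List (V × V) :=
  open Classical in L.filter fun e => s(e.1, e.2) ∈ π.bridgeEdges

theorem mem_bridges {π : Split V} {L : List (V × V)} {e : V × V} :
    e ∈ π.bridges L ↔ e ∈ L ∧ s(e.1, e.2) ∈ π.bridgeEdges := by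
  classical
  simp [bridges]

theorem numBridges_congr {π : Split V} {L M : List (V × V)}
    (h : ∀ e, s(e.1, e.2) ∈ π.bridgeEdges → (e ∈ L ↔ e ∈ M)) :
    π.numBridges L = π.numBridges M := by
  unfold numBridges
  congr 1
  ext x
  simp only [Set.mem_ofPred_eq]
  constructor
  · rintro ⟨⟨e, he, rfl⟩, hx⟩
    exact ⟨⟨e, (h e hx).1 he, rfl⟩, hx⟩
  · rintro ⟨⟨e, he, rfl⟩, hx⟩
    exact ⟨⟨e, (h e hx).2 he, rfl⟩, hx⟩

theorem exists_parts_of_bridge {π : Split V} {e : V × V}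
    (he : s(e.1, e.2) ∈ π.bridgeEdges) :
    ∃ A ∈ π.parts, ∃ B ∈ π.parts, A ≠ B ∧ e.1 ∈ A ∧ e.2 ∈ B := by
  obtain ⟨A, hA, B, hB, hAB, u, hu, v, hv, hx⟩ := he
  rcases Sym2.eq_iff.1 hx with ⟨h3, h4⟩ | ⟨h3, h4⟩
  · exact ⟨A, hA, B, hB, hAB, h3 ▸ hu, h4 ▸ hv⟩
  · exact ⟨B, hB, A, hA, hAB.symm, h3 ▸ hv, h4 ▸ hu⟩

/-- Replace every edge `e` that lies inside a part `D` by the list `σ D e`. -/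
noncomputable def spread (π : Split V) (σ : Finset V → V × V → List (V × V)) (e : V × V) :
    List (V × V) :=
  open Classical in
  if h : ∃ D ∈ π.parts, e.1 ∈ D ∧ e.2 ∈ D then σ h.choose e else [e]

variable [MetricSpace V] {π : Split V} {m β : ℝ} {C : Finset V}

namespace IsSplitOf

theorem unique (h : π.IsSplitOf m β C) {A B : Finset V} (hA : A ∈ π.parts) (hB : B ∈ π.parts)
    {u : V} (hu : u ∈ A) (hu' : u ∈ B) : A = B :=
  (h.2.1 u ((h.1 A hA).2 hu)).unique ⟨hA, hu⟩ ⟨hB, hu'⟩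

theorem bridge_subset (h : π.IsSplitOf m β C) {e : V × V}
    (he : s(e.1, e.2) ∈ π.bridgeEdges) : e.1 ∈ C ∧ e.2 ∈ C := by
  obtain ⟨A, hA, B, hB, -, u, hu, v, hv, hx⟩ := he
  have h1 := (h.1 A hA).2 hu
  have h2 := (h.1 B hB).2 hv
  rcases Sym2.eq_iff.1 hx with ⟨h3, h4⟩ | ⟨h3, h4⟩ <;> rw [h3, h4] <;>
    exact ⟨by assumption, by assumption⟩

theorem not_bridge (h : π.IsSplitOf m β C) {D : Finset V} (hD : D ∈ π.parts) {e : V × V}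
    (he : e.1 ∈ D ∧ e.2 ∈ D) : s(e.1, e.2) ∉ π.bridgeEdges := by
  rintro ⟨A, hA, B, hB, hAB, u, hu, v, hv, hx⟩
  rcases Sym2.eq_iff.1 hx with ⟨h3, h4⟩ | ⟨h3, h4⟩ <;> rw [h3, h4] at he
  · exact hAB ((h.unique hA hD hu he.1).trans (h.unique hB hD hv he.2).symm)
  · exact hAB ((h.unique hA hD hu he.2).trans (h.unique hB hD hv he.1).symm)

theorem exists_part_of_not_bridge (h : π.IsSplitOf m β C) {e : V × V} (heC : e.1 ∈ C ∧ e.2 ∈ C)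
    (he : s(e.1, e.2) ∉ π.bridgeEdges) : ∃ D ∈ π.parts, e.1 ∈ D ∧ e.2 ∈ D := by
  obtain ⟨A, ⟨hA, h1⟩, -⟩ := h.2.1 e.1 heC.1
  obtain ⟨B, ⟨hB, h2⟩, -⟩ := h.2.1 e.2 heC.2
  by_cases hAB : A = B
  · exact ⟨A, hA, h1, hAB ▸ h2⟩
  · exact absurd ⟨A, hA, B, hB, hAB, e.1, h1, e.2, h2, rfl⟩ he

theorem spread_of_mem (h : π.IsSplitOf m β C) (σ : Finset V → V × V → List (V × V))
    {D : Finset V} (hD : D ∈ π.parts) {e : V × V} (he : e.1 ∈ D ∧ e.2 ∈ D) :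
    π.spread σ e = σ D e := by
  have hex : ∃ D ∈ π.parts, e.1 ∈ D ∧ e.2 ∈ D := ⟨D, hD, he⟩
  rw [spread, dif_pos hex]
  rw [h.unique hex.choose_spec.1 hD hex.choose_spec.2.1 he.1]

theorem spread_of_bridge (h : π.IsSplitOf m β C) (σ : Finset V → V × V → List (V × V))
    {e : V × V} (he : s(e.1, e.2) ∈ π.bridgeEdges) : π.spread σ e = [e] := by
  rw [spread, dif_neg]
  rintro ⟨D, hD, heD⟩
  exact h.not_bridge hD heD he

theorem inside_flatMap_spread [DecidableEq V] (h : π.IsSplitOf m β C)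
    {σ : Finset V → V × V → List (V × V)}
    (hσ : ∀ D ∈ π.parts, ∀ e : V × V, e.1 ∈ D ∧ e.2 ∈ D → ∀ f ∈ σ D e, f.1 ∈ D ∧ f.2 ∈ D)
    {M : List (V × V)} (hM : ∀ e ∈ M, e.1 ∈ C ∧ e.2 ∈ C) {D : Finset V} (hD : D ∈ π.parts) :
    inside D (M.flatMap (π.spread σ)) = (inside D M).flatMap (σ D) := by
  induction M with
  | nil => rfl
  | cons e M ih =>
    have ih := ih fun f hf => hM f (List.mem_cons_of_mem _ hf)
    have heC := hM e List.mem_cons_self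
    rw [List.flatMap_cons]
    have happ : ∀ L M : List (V × V), inside D (L ++ M) = inside D L ++ inside D M :=
      fun _ _ => List.filter_append _ _
    have hcons : inside D (e :: M) = if e.1 ∈ D ∧ e.2 ∈ D then e :: inside D M else inside D M := by
      simp [inside, List.filter_cons]
    rw [happ, ih, hcons]
    by_cases he : e.1 ∈ D ∧ e.2 ∈ D
    · rw [if_pos he, List.flatMap_cons, h.spread_of_mem σ hD he, inside_eq_self (hσ D hD e he)]
    · rw [if_neg he]
      have : inside D (π.spread σ e) = [] := by
        refine List.filter_eq_nil_iff.2 fun f hf hfD => ?_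
        simp only [decide_eq_true_eq] at hfD
        by_cases hb : s(e.1, e.2) ∈ π.bridgeEdges
        · rw [h.spread_of_bridge σ hb, List.mem_singleton] at hf
          exact he (hf ▸ hfD)
        · obtain ⟨B, hB, heB⟩ := h.exists_part_of_not_bridge heC hb
          rw [h.spread_of_mem σ hB heB] at hf
          have := h.unique hB hD (hσ B hB e heB f hf).1 hfD.1
          exact he (this ▸ heB)
      rw [this, List.nil_append]

theorem bridges_flatMap_spread (h : π.IsSplitOf m β C)
    {σ : Finset V → V × V → List (V × V)}
    (hσ : ∀ D ∈ π.parts, ∀ e : V × V, e.1 ∈ D ∧ e.2 ∈ D → ∀ f ∈ σ D e, f.1 ∈ D ∧ f.2 ∈ D)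
    {M : List (V × V)} (hM : ∀ e ∈ M, e.1 ∈ C ∧ e.2 ∈ C) :
    π.bridges (M.flatMap (π.spread σ)) = π.bridges M := by
  classical
  induction M with
  | nil => rfl
  | cons e M ih =>
    have ih := ih fun f hf => hM f (List.mem_cons_of_mem _ hf)
    have heC := hM e List.mem_cons_self
    rw [List.flatMap_cons]
    have happ : ∀ L M : List (V × V), π.bridges (L ++ M) = π.bridges L ++ π.bridges M :=
      fun _ _ => List.filter_append _ _
    have hcons : π.bridges (e :: M) = π.bridges [e] ++ π.bridges M := happ [e] M
    rw [happ, ih, hcons]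
    by_cases hb : s(e.1, e.2) ∈ π.bridgeEdges
    · rw [h.spread_of_bridge σ hb]
    · obtain ⟨B, hB, heB⟩ := h.exists_part_of_not_bridge heC hb
      rw [h.spread_of_mem σ hB heB]
      have h1 : π.bridges (σ B e) = [] :=
        List.eq_nil_iff_forall_not_mem.2 fun f hf =>
          h.not_bridge hB (hσ B hB e heB f (mem_bridges.1 hf).1) (mem_bridges.1 hf).2
      have h2 : π.bridges [e] = [] :=
        List.eq_nil_iff_forall_not_mem.2 fun f hf => by
          obtain ⟨h3, h4⟩ := mem_bridges.1 hf
          rw [List.mem_singleton] at h3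
          exact hb (h3 ▸ h4)
      rw [h1, h2]

theorem totalLen_eq [DecidableEq V] (h : π.IsSplitOf m β C) {M : List (V × V)}
    (hM : ∀ e ∈ M, e.1 ∈ C ∧ e.2 ∈ C) :
    totalLen M = totalLen (π.bridges M) + ∑ D ∈ π.parts, totalLen (inside D M) := by
  classical
  induction M with
  | nil => simp [bridges, inside]
  | cons e M ih =>
    have ih := ih fun f hf => hM f (List.mem_cons_of_mem _ hf)
    have heC := hM e List.mem_cons_self
    have hcons : ∀ D, totalLen (inside D (e :: M)) =
        (if e.1 ∈ D ∧ e.2 ∈ D then dist e.1 e.2 else 0) + totalLen (inside D M) := by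
      intro D
      simp only [inside, List.filter_cons, decide_eq_true_eq]
      split_ifs <;> simp
    simp only [hcons, Finset.sum_add_distrib]
    rw [totalLen_cons, ih]
    by_cases hb : s(e.1, e.2) ∈ π.bridgeEdges
    · have h1 : π.bridges (e :: M) = e :: π.bridges M := by simp [bridges, hb]
      rw [h1, totalLen_cons, Finset.sum_eq_zero fun D hD => if_neg fun he => h.not_bridge hD he hb]
      ring
    · have h1 : π.bridges (e :: M) = π.bridges M := by simp [bridges, hb]
      obtain ⟨B, hB, heB⟩ := h.exists_part_of_not_bridge heC hb
      rw [h1, Finset.sum_eq_single_of_mem B hB fun D hD hne => if_neg fun he =>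
        hne (h.unique hD hB he.1 heB.1), if_pos heB]
      ring

theorem totalLen_flatMap_spread_le [DecidableEq V] (h : π.IsSplitOf m β C)
    {σ : Finset V → V × V → List (V × V)}
    (hσ : ∀ D ∈ π.parts, ∀ e : V × V, e.1 ∈ D ∧ e.2 ∈ D → ∀ f ∈ σ D e, f.1 ∈ D ∧ f.2 ∈ D)
    {M : List (V × V)} (hM : ∀ e ∈ M, e.1 ∈ C ∧ e.2 ∈ C) {c : ℝ} (hc : 1 ≤ c)
    (hle : ∀ D ∈ π.parts, totalLen ((inside D M).flatMap (σ D)) ≤ c * totalLen (inside D M)) :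
    totalLen (M.flatMap (π.spread σ)) ≤ c * totalLen M := by
  have hM' : ∀ f ∈ M.flatMap (π.spread σ), f.1 ∈ C ∧ f.2 ∈ C := by
    intro f hf
    obtain ⟨e, he, hf⟩ := List.mem_flatMap.1 hf
    by_cases hb : s(e.1, e.2) ∈ π.bridgeEdges
    · rw [h.spread_of_bridge σ hb, List.mem_singleton] at hf
      exact hf ▸ hM e he
    · obtain ⟨B, hB, heB⟩ := h.exists_part_of_not_bridge (hM e he) hb
      rw [h.spread_of_mem σ hB heB] at hf
      have := hσ B hB e heB f hf
      exact ⟨(h.1 B hB).2 this.1, (h.1 B hB).2 this.2⟩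
  rw [h.totalLen_eq hM', h.totalLen_eq hM, h.bridges_flatMap_spread hσ hM, mul_add,
    Finset.mul_sum]
  refine add_le_add ?_ (Finset.sum_le_sum fun D hD => ?_)
  · nlinarith [totalLen_nonneg (π.bridges M)]
  · rw [h.inside_flatMap_spread hσ hM hD]
    exact hle D hD

end IsSplitOf

/-! ### Rerouting through portals -/

/-- A portal of the part of `u` that is within distance `β * diam` of `u`. -/
noncomputable def portalOf (β : ℝ) (π : Split V) (u : V) : V :=
  open Classical in
  if h : ∃ c, ∃ A ∈ π.parts, u ∈ A ∧ c ∈ π.portals A ∧ dist u c ≤ β * Metric.diam (A : Set V)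
  then h.choose else u

theorem IsSplitOf.portalOf_spec (h : π.IsSplitOf m β C) {A : Finset V} (hA : A ∈ π.parts) {u : V}
    (hu : u ∈ A) : portalOf β π u ∈ π.portals A ∧ portalOf β π u ∈ A ∧
      dist u (portalOf β π u) ≤ β * Metric.diam (A : Set V) := by
  obtain ⟨c, hc, hd⟩ := (h.2.2.2.2 A hA).2.2 u hu
  have hex : ∃ c, ∃ A ∈ π.parts, u ∈ A ∧ c ∈ π.portals A ∧
    dist u c ≤ β * Metric.diam (A : Set V) := ⟨c, A, hA, hu, hc, hd⟩
  rw [portalOf, dif_pos hex]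
  obtain ⟨B, hB, huB, h1, h2⟩ := hex.choose_spec
  obtain rfl := h.unique hB hA huB hu
  exact ⟨h1, (h.2.2.2.2 B hB).1 h1, h2⟩

/-- A bridge-edge is replaced by the detour through a portal of the part of each of its ends. -/
noncomputable def reroute (β : ℝ) (π : Split V) (e : V × V) : List (V × V) :=
  open Classical in
  if s(e.1, e.2) ∈ π.bridgeEdges then
    [(e.1, portalOf β π e.1), (portalOf β π e.1, portalOf β π e.2), (portalOf β π e.2, e.2)]
  else [e]

theorem joins_reroute (β : ℝ) (π : Split V) (e : V × V) : Joins e.1 (reroute β π e) e.2 := by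
  unfold reroute
  split_ifs <;> simp [Joins]

theorem IsSplitOf.reroute_subset (h : π.IsSplitOf m β C) {e : V × V} (heC : e.1 ∈ C ∧ e.2 ∈ C) :
    ∀ f ∈ reroute β π e, f.1 ∈ C ∧ f.2 ∈ C := by
  intro f hf
  unfold reroute at hf
  split_ifs at hf with hb
  · obtain ⟨A, hA, B, hB, -, hu, hv⟩ := exists_parts_of_bridge hb
    have h1 := (h.1 A hA).2 (h.portalOf_spec hA hu).2.1
    have h2 := (h.1 B hB).2 (h.portalOf_spec hB hv).2.1
    simp only [List.mem_cons, List.not_mem_nil, or_false] at hf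
    rcases hf with rfl | rfl | rfl
    · exact ⟨heC.1, h1⟩
    · exact ⟨h1, h2⟩
    · exact ⟨h2, heC.2⟩
  · rw [List.mem_singleton] at hf
    exact hf ▸ heC

theorem IsSplitOf.portal_of_mem_reroute (h : π.IsSplitOf m β C) {e f : V × V}
    (hf : f ∈ reroute β π e) (hfb : s(f.1, f.2) ∈ π.bridgeEdges) :
    s(f.1, f.2) ∈ π.portalEdges := by
  unfold reroute at hf
  split_ifs at hf with hb
  · obtain ⟨A, hA, B, hB, hAB, hu, hv⟩ := exists_parts_of_bridge hb
    obtain ⟨h1, h1', -⟩ := h.portalOf_spec hA hu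
    obtain ⟨h2, h2', -⟩ := h.portalOf_spec hB hv
    simp only [List.mem_cons, List.not_mem_nil, or_false] at hf
    rcases hf with rfl | rfl | rfl
    · exact absurd hfb (h.not_bridge hA ⟨hu, h1'⟩)
    · exact ⟨A, hA, B, hB, hAB, _, h1, _, h2, rfl⟩
    · exact absurd hfb (h.not_bridge hB ⟨h2', hv⟩)
  · rw [List.mem_singleton] at hf
    exact absurd (hf ▸ hfb) hb

theorem IsSplitOf.totalLen_reroute_le (h : π.IsSplitOf m β C) (hβ : 0 ≤ β) (L : List (V × V)) :
    totalLen (L.flatMap (reroute β π)) ≤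
      totalLen L + (π.bridges L).length * (2 * β * Metric.diam (C : Set V)) := by
  classical
  induction L with
  | nil => simp [bridges]
  | cons e L ih =>
    rw [List.flatMap_cons, totalLen_append, totalLen_cons]
    by_cases hb : s(e.1, e.2) ∈ π.bridgeEdges
    · have h1 : π.bridges (e :: L) = e :: π.bridges L := by simp [bridges, hb]
      obtain ⟨A, hA, B, hB, -, hu, hv⟩ := exists_parts_of_bridge hb
      obtain ⟨-, -, h3⟩ := h.portalOf_spec hA hu
      obtain ⟨-, -, h4⟩ := h.portalOf_spec hB hv
      have hA2 := mul_le_mul_of_nonneg_left (h.2.2.2.1 A hA) hβ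
      have hB2 := mul_le_mul_of_nonneg_left (h.2.2.2.1 B hB) hβ
      have h5 := dist_triangle4 (portalOf β π e.1) e.1 e.2 (portalOf β π e.2)
      rw [dist_comm (portalOf β π e.1) e.1] at h5
      have h6 : totalLen (reroute β π e) ≤
          dist e.1 e.2 + 2 * β * Metric.diam (C : Set V) := by
        rw [reroute, if_pos hb]
        simp only [totalLen_cons, totalLen_nil]
        rw [dist_comm (portalOf β π e.2) e.2]
        linarith
      rw [h1, List.length_cons]
      push_cast
      linarith
    · have h1 : π.bridges (e :: L) = π.bridges L := by simp [bridges, hb]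
      rw [h1, reroute, if_neg hb]
      simp only [totalLen_cons, totalLen_nil]
      linarith

/-- Reroute the bridge-edges of `L` through portals if there are more than `N₁` different ones. -/
noncomputable def step (β N₁ : ℝ) (π : Split V) (L : List (V × V)) : List (V × V) :=
  open Classical in
  if N₁ < π.numBridges L then L.flatMap (reroute β π) else L

/-- The list `L` crosses between the parts of the split at most twice as often as expected. -/
def IsGood (κ₀ : ℝ) (C : Finset V) (L : List (V × V)) (π : Split V) : Prop :=
  ((π.bridges L).length : ℝ) ≤ 2 * (κ₀ * totalLen L / Metric.diam (C : Set V))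

theorem IsSplitOf.step_subset (h : π.IsSplitOf m β C) {N₁ : ℝ} {L : List (V × V)}
    (hL : ∀ e ∈ L, e.1 ∈ C ∧ e.2 ∈ C) : ∀ e ∈ step β N₁ π L, e.1 ∈ C ∧ e.2 ∈ C := by
  intro f hf
  unfold step at hf
  split_ifs at hf
  · obtain ⟨e, he, hf⟩ := List.mem_flatMap.1 hf
    exact h.reroute_subset (hL e he) f hf
  · exact hL f hf

theorem IsSplitOf.totalLen_step_le (h : π.IsSplitOf m β C) (hβ : 0 ≤ β) {κ₀ N₁ : ℝ}
    (hκ₀ : 0 ≤ κ₀) {L : List (V × V)} (hC : 0 < Metric.diam (C : Set V))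
    (hgood : IsGood κ₀ C L π) :
    totalLen (step β N₁ π L) ≤ (1 + 4 * β * κ₀) * totalLen L := by
  have h0 := totalLen_nonneg L
  unfold step
  split_ifs
  · refine (h.totalLen_reroute_le hβ L).trans ?_
    have h1 := mul_le_mul_of_nonneg_right hgood
      (show 0 ≤ 2 * β * Metric.diam (C : Set V) by positivity)
    have h2 : 2 * (κ₀ * totalLen L / Metric.diam (C : Set V)) * (2 * β * Metric.diam (C : Set V)) =
        4 * β * κ₀ * totalLen L := by field_simp; ring
    linarith
  · have : 0 ≤ 4 * β * κ₀ * totalLen L := by positivity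
    linarith

end Split

/-! ### The rerouted walk on an induced decomposition -/

namespace SplitTree

variable {V : Type*} [Fintype V] {γ : ℕ} {a : ℕ} {m β : ℝ} {Γ : SplitTree V γ}
  {Φ : Addr V γ → Option (Fin γ)}

theorem IsInducedNode.isNode {p : Addr V γ} (hp : IsInducedNode a Γ Φ p) : IsNode a Γ p := by
  induction hp with
  | root => exact .root
  | step _ hc _ hD ih => exact .step ih hc hD

/-- The branch taken from an induced node `p` towards a node `q` strictly below it. -/
theorem IsInducedNode.exists_child {p q : Addr V γ} (hq : IsInducedNode a Γ Φ q) (hpq : p <:+ q)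
    (hne : p ≠ q) : IsInducedNode a Γ Φ p ∧ a < p.cluster.card ∧ ∃ i D, Φ p = some i ∧
      D ∈ (Γ (p, i)).parts ∧ IsInducedNode a Γ Φ ((i, D) :: p) ∧ (i, D) :: p <:+ q := by
  induction hq with
  | root => exact absurd (List.suffix_nil.1 hpq) hne
  | @step q i D hq hc hi hD ih =>
    rcases List.suffix_cons_iff.1 hpq with rfl | h
    · exact absurd rfl hne
    · by_cases hpq' : p = q
      · subst hpq'
        exact ⟨hq, hc, i, D, hi, hD, .step hq hc hi hD, List.suffix_refl _⟩
      · obtain ⟨h1, h2, j, E, h3, h4, h5, h6⟩ := ih h hpq'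
        exact ⟨h1, h2, j, E, h3, h4, h5, h6.trans (List.suffix_cons _ _)⟩

variable [MetricSpace V]

theorem IsSplitTree.isSplitOf (hΓ : Γ.IsSplitTree a m β) {p : Addr V γ}
    (hp : IsInducedNode a Γ Φ p) (hc : a < p.cluster.card) (i : Fin γ) :
    (Γ (p, i)).IsSplitOf m β p.cluster :=
  hΓ p hp.isNode hc i

theorem IsInducedNode.cluster_subset (hΓ : Γ.IsSplitTree a m β) {p q : Addr V γ}
    (hq : IsInducedNode a Γ Φ q) (hpq : p <:+ q) : q.cluster ⊆ p.cluster := by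
  induction hq with
  | root => rw [List.suffix_nil.1 hpq]
  | @step q i D hq hc hi hD ih =>
    rcases List.suffix_cons_iff.1 hpq with rfl | h
    · exact Finset.Subset.refl _
    · exact (((hΓ.isSplitOf hq hc i).1 D hD).2).trans (ih h)

variable [DecidableEq V]

/-- The edges inside the cluster of `p` of the walk that arises from the edges `E` by rerouting
at all proper ancestors of `p`, where the address `p` tells which split is used at an ancestor. -/
noncomputable def edgesAt (β N₁ : ℝ) (E : List (V × V)) (Γ : SplitTree V γ) :
    Addr V γ → List (V × V)
  | [] => E
  | (i, D) :: p => inside D (Split.step β N₁ (Γ (p, i)) (edgesAt β N₁ E Γ p))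

theorem edgesAt_subset {N₁ : ℝ} {E : List (V × V)} (p : Addr V γ) :
    ∀ e ∈ edgesAt β N₁ E Γ p, e.1 ∈ p.cluster ∧ e.2 ∈ p.cluster := by
  rcases p with _ | ⟨⟨i, D⟩, p⟩
  · simp [Addr.cluster]
  · exact fun e he => (mem_inside.1 he).2

/-- The nodes at which edges are rerouted. -/
def rerouted (β N₁ : ℝ) (E : List (V × V)) (Γ : SplitTree V γ) (Φ : Addr V γ → Option (Fin γ)) :
    Set (Addr V γ) :=
  {p | ∃ i, Φ p = some i ∧ N₁ < (Γ (p, i)).numBridges (edgesAt β N₁ E Γ p)}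

/-- The rerouting below a node `p`: every edge `e` inside the cluster of `p` is replaced by a walk
`σ e` inside the cluster. Every level of the tree multiplies the length by at most `1 + 4 β κ₀`, and
there are at most `h` levels of non-leaves below `p` when the diameter is less than `2 ^ h`. At a
node `q` below `p` the length bound is relative to the edges inside the cluster of `q`, and
therefore needs that nothing is rerouted at nodes from `p` down to the parent of `q`. -/
theorem exists_rerouting (hd : ∀ u v : V, u ≠ v → 1 ≤ dist u v) (ha : 1 ≤ a)
    (hΓ : Γ.IsSplitTree a m β) (hΦ : Γ.IsDetermining a Φ) {κ₀ N₁ : ℝ} (hβ : 0 ≤ β) (hκ₀ : 0 ≤ κ₀)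
    {E : List (V × V)}
    (hgood : ∀ p, IsInducedNode a Γ Φ p → a < p.cluster.card → ∀ i, Φ p = some i →
      Split.IsGood κ₀ p.cluster (edgesAt β N₁ E Γ p) (Γ (p, i))) (h : ℕ) (p : Addr V γ)
    (hp : IsInducedNode a Γ Φ p) (hdiam : Metric.diam (p.cluster : Set V) < 2 ^ h) :
    ∃ σ : V × V → List (V × V),
      (∀ e : V × V, e.1 ∈ p.cluster ∧ e.2 ∈ p.cluster → Joins e.1 (σ e) e.2 ∧
        ∀ f ∈ σ e, f.1 ∈ p.cluster ∧ f.2 ∈ p.cluster) ∧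
      (∀ q, IsInducedNode a Γ Φ q → p <:+ q →
        (∀ r ∈ rerouted β N₁ E Γ Φ, p <:+ r → r <:+ q → r = q) →
        totalLen (inside q.cluster ((edgesAt β N₁ E Γ p).flatMap σ)) ≤
          (1 + 4 * β * κ₀) ^ h * totalLen (inside q.cluster (edgesAt β N₁ E Γ p))) ∧
      ∀ q, IsInducedNode a Γ Φ q → a < q.cluster.card → p <:+ q → ∀ i, Φ q = some i →
        (q ∉ rerouted β N₁ E Γ Φ →
          ((Γ (q, i)).numBridges ((edgesAt β N₁ E Γ p).flatMap σ) : ℝ) ≤ N₁) ∧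
        (q ∈ rerouted β N₁ E Γ Φ → ∀ e ∈ (edgesAt β N₁ E Γ p).flatMap σ,
          s(e.1, e.2) ∈ (Γ (q, i)).bridgeEdges → s(e.1, e.2) ∈ (Γ (q, i)).portalEdges) := by
  classical
  set x := 4 * β * κ₀ with hx
  have hx0 : 0 ≤ x := by positivity
  have hx1 : ∀ k : ℕ, 1 ≤ (1 + x) ^ k := fun k => one_le_pow₀ (by linarith)
  induction h generalizing p with
  | zero =>
    -- the cluster has at most one point
    have hleaf : ¬ a < p.cluster.card := fun hc => by
      have := one_le_diam hd (lt_of_le_of_lt ha hc)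
      simp only [pow_zero] at hdiam
      linarith
    refine ⟨fun e => [e], fun e he => ⟨by simp [Joins], by simpa using he⟩, ?_, ?_⟩
    · intro q _ _ _
      simp
    · intro q hq hc hpq
      obtain rfl : p = q := by
        by_contra hne
        exact hleaf (hq.exists_child hpq hne).2.1
      exact absurd hc hleaf
  | succ h ih =>
    by_cases hc : a < p.cluster.card
    swap
    · refine ⟨fun e => [e], fun e he => ⟨by simp [Joins], by simpa using he⟩, ?_, ?_⟩
      · intro q _ _ _
        rw [List.flatMap_singleton']
        nlinarith [totalLen_nonneg (inside q.cluster (edgesAt β N₁ E Γ p)), hx1 (h + 1)]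
      · intro q hq hc' hpq
        obtain rfl : p = q := by
          by_contra hne
          exact hc (hq.exists_child hpq hne).2.1
        exact absurd hc' hc
    obtain ⟨i, hi⟩ := hΦ p hp hc
    set π := Γ (p, i) with hπdef
    set L := edgesAt β N₁ E Γ p with hL
    have hπ : π.IsSplitOf m β p.cluster := hΓ.isSplitOf hp hc i
    have hLC : ∀ e ∈ L, e.1 ∈ p.cluster ∧ e.2 ∈ p.cluster := edgesAt_subset p
    have hdpos : 0 < Metric.diam (p.cluster : Set V) :=
      lt_of_lt_of_le one_pos (one_le_diam hd (lt_of_le_of_lt ha hc))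
    have hmem : p ∈ rerouted β N₁ E Γ Φ ↔ N₁ < π.numBridges L := by
      constructor
      · rintro ⟨j, hj, h1⟩
        rw [hi, Option.some_inj] at hj
        rwa [← hj] at h1
      · exact fun h1 => ⟨i, hi, h1⟩
    have hchild : ∀ D ∈ π.parts, IsInducedNode a Γ Φ ((i, D) :: p) := fun D hD =>
      .step hp hc hi hD
    choose! σ hσ1 hσ2 hσ3 using fun D (hD : D ∈ π.parts) => ih ((i, D) :: p) (hchild D hD) (by
      have h1 := hπ.2.2.2.1 D hD
      rw [pow_succ] at hdiam
      change Metric.diam (D : Set V) < 2 ^ h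
      linarith)
    have hσ1' : ∀ D ∈ π.parts, ∀ e : V × V, e.1 ∈ D ∧ e.2 ∈ D → ∀ f ∈ σ D e,
        f.1 ∈ D ∧ f.2 ∈ D := fun D hD e he => (hσ1 D hD e he).2
    have hspread : ∀ e : V × V, e.1 ∈ p.cluster ∧ e.2 ∈ p.cluster →
        Joins e.1 (π.spread σ e) e.2 ∧ ∀ f ∈ π.spread σ e, f.1 ∈ p.cluster ∧ f.2 ∈ p.cluster := by
      intro e he
      by_cases hb : s(e.1, e.2) ∈ π.bridgeEdges
      · rw [hπ.spread_of_bridge σ hb]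
        exact ⟨by simp [Joins], by simpa using he⟩
      · obtain ⟨D, hD, heD⟩ := hπ.exists_part_of_not_bridge he hb
        rw [hπ.spread_of_mem σ hD heD]
        refine ⟨(hσ1 D hD e heD).1, fun f hf => ?_⟩
        have h1 := hσ1' D hD e heD f hf
        exact ⟨(hπ.1 D hD).2 h1.1, (hπ.1 D hD).2 h1.2⟩
    set ρ : V × V → List (V × V) := fun e =>
      if p ∈ rerouted β N₁ E Γ Φ then Split.reroute β π e else [e] with hρ
    have hρ1 : ∀ e : V × V, e.1 ∈ p.cluster ∧ e.2 ∈ p.cluster → Joins e.1 (ρ e) e.2 ∧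
        ∀ f ∈ ρ e, f.1 ∈ p.cluster ∧ f.2 ∈ p.cluster := by
      intro e he
      simp only [hρ]
      split_ifs
      · exact ⟨Split.joins_reroute β π e, hπ.reroute_subset he⟩
      · exact ⟨by simp [Joins], by simpa using he⟩
    have hstep : L.flatMap ρ = Split.step β N₁ π L := by
      rw [Split.step]
      simp only [hρ, hmem]
      split_ifs
      · rfl
      · rw [List.flatMap_singleton']
    set M := Split.step β N₁ π L with hM
    have hMC : ∀ e ∈ M, e.1 ∈ p.cluster ∧ e.2 ∈ p.cluster := hπ.step_subset hLC
    have hF : L.flatMap (fun e => (ρ e).flatMap (π.spread σ)) = M.flatMap (π.spread σ) := by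
      rw [← hstep, List.flatMap_assoc]
    have hFD : ∀ D ∈ π.parts, inside D (M.flatMap (π.spread σ)) =
        (edgesAt β N₁ E Γ ((i, D) :: p)).flatMap (σ D) := fun D hD =>
      hπ.inside_flatMap_spread hσ1' hMC hD
    have hMbridge : ∀ e : V × V, s(e.1, e.2) ∈ π.bridgeEdges →
        (e ∈ M.flatMap (π.spread σ) ↔ e ∈ M) := by
      intro e he
      have h1 := congrArg (e ∈ ·) (hπ.bridges_flatMap_spread hσ1' hMC)
      simpa [Split.mem_bridges, he] using h1
    refine ⟨fun e => (ρ e).flatMap (π.spread σ), ?_, ?_, ?_⟩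
    · intro e he
      refine ⟨(hρ1 e he).1.flatMap fun f hf => (hspread f ((hρ1 e he).2 f hf)).1, fun g hg => ?_⟩
      obtain ⟨f, hf, hg⟩ := List.mem_flatMap.1 hg
      exact (hspread f ((hρ1 e he).2 f hf)).2 g hg
    · intro q hq hpq hbetween
      rw [hF]
      by_cases hne : p = q
      · subst hne
        have hFC : ∀ f ∈ M.flatMap (π.spread σ), f.1 ∈ p.cluster ∧ f.2 ∈ p.cluster := by
          intro g hg
          obtain ⟨f, hf, hg⟩ := List.mem_flatMap.1 hg
          exact (hspread f (hMC f hf)).2 g hg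
        rw [inside_eq_self hFC, inside_eq_self hLC]
        have h1 : totalLen (M.flatMap (π.spread σ)) ≤ (1 + x) ^ h * totalLen M := by
          refine hπ.totalLen_flatMap_spread_le hσ1' hMC (hx1 h) fun D hD => ?_
          have h2 := hσ2 D hD ((i, D) :: p) (hchild D hD) (List.suffix_refl _)
            fun r _ h3 h4 => h4.eq_of_length (le_antisymm h4.length_le h3.length_le)
          change totalLen (inside D _) ≤ _ * totalLen (inside D _) at h2
          rwa [inside_eq_self (C := D) (L := edgesAt β N₁ E Γ ((i, D) :: p))
            (edgesAt_subset ((i, D) :: p)), ← hFD D hD, inside_inside (Finset.Subset.refl D),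
            hFD D hD] at h2
        have h2 := hπ.totalLen_step_le (N₁ := N₁) hβ hκ₀ hdpos (hgood p hp hc i hi)
        calc _ ≤ (1 + x) ^ h * totalLen M := h1
          _ ≤ (1 + x) ^ h * ((1 + x) * totalLen L) := by gcongr
          _ = _ := by ring
      · obtain ⟨-, -, j, D, hj, hD, hchildq, hsuf⟩ := hq.exists_child hpq hne
        obtain rfl : i = j := Option.some_inj.1 (hi.symm.trans hj)
        -- `p` lies between `p` and `q`, so nothing is rerouted at `p`
        have hpnot : p ∉ rerouted β N₁ E Γ Φ := fun h1 =>
          hne (hbetween p h1 (List.suffix_refl _) hpq)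
        have hML : M = L := by rw [hM, Split.step, if_neg (fun h1 => hpnot (hmem.2 h1))]
        have hqD : q.cluster ⊆ D := hq.cluster_subset hΓ hsuf
        have h1 := hσ2 D hD q hq hsuf fun r hr h2 h3 =>
          hbetween r hr ((List.suffix_cons _ _).trans h2) h3
        rw [← hFD D hD, inside_inside hqD] at h1
        have h2 : edgesAt β N₁ E Γ ((i, D) :: p) = inside D L := by
          change inside D M = inside D L
          rw [hML]
        rw [h2, inside_inside hqD] at h1
        refine h1.trans (mul_le_mul_of_nonneg_right ?_ (totalLen_nonneg _))
        exact pow_le_pow_right₀ (by linarith) (Nat.le_succ h)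
    · intro q hq hcq hpq j hj
      rw [hF]
      by_cases hne : p = q
      · subst hne
        obtain rfl : i = j := Option.some_inj.1 (hi.symm.trans hj)
        rw [← hπdef, Split.numBridges_congr hMbridge]
        constructor
        · intro hnot
          have h1 : ¬ N₁ < π.numBridges L := fun h1 => hnot (hmem.2 h1)
          rw [hM, Split.step, if_neg h1]
          exact not_lt.1 h1
        · intro hin e he hb
          have he' := (hMbridge e hb).1 he
          rw [hM, Split.step, if_pos (hmem.1 hin)] at he'
          obtain ⟨f, -, hf⟩ := List.mem_flatMap.1 he'
          exact hπ.portal_of_mem_reroute hf hb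
      · obtain ⟨-, -, j', D, hj', hD, hchildq, hsuf⟩ := hq.exists_child hpq hne
        obtain rfl : i = j' := Option.some_inj.1 (hi.symm.trans hj')
        have hqD : q.cluster ⊆ D := hq.cluster_subset hΓ hsuf
        have h1 := hσ3 D hD q hq hcq hsuf j hj
        have h2 : ∀ e : V × V, s(e.1, e.2) ∈ (Γ (q, j)).bridgeEdges →
            (e ∈ M.flatMap (π.spread σ) ↔
              e ∈ (edgesAt β N₁ E Γ ((i, D) :: p)).flatMap (σ D)) := by
          intro e he
          have h3 := (hΓ.isSplitOf hq hcq j).bridge_subset he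
          rw [← hFD D hD, mem_inside]
          exact ⟨fun h4 => ⟨h4, hqD h3.1, hqD h3.2⟩, fun h4 => h4.1⟩
        rw [Split.numBridges_congr h2]
        exact ⟨h1.1, fun h3 e he hb => h1.2 h3 e ((h2 e hb).1 he) hb⟩

/-- If all splits chosen by `Φ` are good, then an `s`-`t` walk can be rerouted so that it is
portal-respecting. -/
theorem exists_portalRespecting (hd : ∀ u v : V, u ≠ v → 1 ≤ dist u v) (ha : 1 ≤ a)
    (hΓ : Γ.IsSplitTree a m β) (hΦ : Γ.IsDetermining a Φ) {κ₀ N₁ N₂ ε : ℝ} (hβ : 0 ≤ β)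
    (hκ₀ : 0 ≤ κ₀) {s t : V} (P : KWalk V s t)
    (hgood : ∀ p, IsInducedNode a Γ Φ p → a < p.cluster.card → ∀ i, Φ p = some i →
      Split.IsGood κ₀ p.cluster (edgesAt β N₁ P.pairs Γ p) (Γ (p, i))) {h : ℕ}
    (hdiam : Metric.diam (Set.univ : Set V) < 2 ^ h) (hε : (1 + 4 * β * κ₀) ^ h ≤ 1 + ε)
    (hN₂ : ∀ p, IsInducedNode a Γ Φ p → a < p.cluster.card → ∀ i,
      (Γ (p, i)).portalEdges.Finite ∧ ((Γ (p, i)).portalEdges.ncard : ℝ) ≤ N₂) :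
    ∃ P' : KWalk V s t, P.numVisited ≤ P'.numVisited ∧ P'.len ≤ (1 + ε) * P.len ∧
      Γ.PortalRespecting a Φ ε N₁ N₂ P P' := by
  obtain ⟨σ, hσ1, hσ2, hσ3⟩ := exists_rerouting hd ha hΓ hΦ hβ hκ₀ hgood h [] .root
    (by simpa [Addr.cluster] using hdiam)
  set F := P.pairs.flatMap σ with hF
  have hσ2' : ∀ q : Addr V γ, IsInducedNode a Γ Φ q →
      (∀ r ∈ rerouted β N₁ P.pairs Γ Φ, r <:+ q → r = q) →
      totalLen (inside q.cluster F) ≤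
        (1 + 4 * β * κ₀) ^ h * totalLen (inside q.cluster P.pairs) := fun q hq hall =>
    hσ2 q hq List.nil_suffix fun r hr _ => hall r hr
  have hjoin : ∀ e : V × V, Joins e.1 (σ e) e.2 := fun e =>
    (hσ1 e (by simp [Addr.cluster])).1
  obtain ⟨P', hP'⟩ := (P.joins_pairs.flatMap fun e _ => hjoin e).exists_walk
  have hlenIn : ∀ C : Finset V, P'.lenIn C = totalLen (inside C F) := by
    intro C
    rw [P'.lenIn_eq, hP', totalLen_inside_filter_ne]
  have hle : ∀ p, IsInducedNode a Γ Φ p →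
      (∀ q ∈ rerouted β N₁ P.pairs Γ Φ, q <:+ p → q = p) →
      P'.lenIn p.cluster ≤ (1 + ε) * P.lenIn p.cluster := by
    intro p hp hall
    rw [hlenIn, P.lenIn_eq]
    exact (hσ2' p hp hall).trans (mul_le_mul_of_nonneg_right hε (totalLen_nonneg _))
  have hpairs : ∀ e : V × V, e ∈ P'.pairs → e ∈ F := by
    intro e he
    rw [hP'] at he
    exact (List.mem_filter.1 he).1
  have hnum : ∀ π : Split V, P'.numEdgesIn π.bridgeEdges ≤ π.numBridges F := by
    intro π
    refine Set.ncard_le_ncard ?_ (Set.toFinite _)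
    rintro x ⟨hx, hxR⟩
    obtain ⟨e, he, rfl⟩ := P'.mem_edges_iff.1 hx
    exact ⟨⟨e, hpairs e he, rfl⟩, hxR⟩
  refine ⟨P', ?_, ?_, rerouted β N₁ P.pairs Γ Φ, ?_, hle⟩
  · refine Finset.card_le_card fun w hw => ?_
    rw [List.mem_toFinset, KWalk.mem_support_iff] at hw ⊢
    refine hw.imp_right ?_
    rintro ⟨e, he, rfl⟩
    obtain ⟨f, hf, hf1, hf2⟩ := (hjoin e).exists_mem_snd (P.ne_of_mem_pairs he)
    refine ⟨f, ?_, hf2⟩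
    rw [hP', List.mem_filter]
    exact ⟨List.mem_flatMap.2 ⟨e, he, hf⟩, by simpa using hf1⟩
  · have huniv : ∀ Q : KWalk V s t, Q.len = Q.lenIn Finset.univ := fun Q => by
      rw [Q.len_eq, Q.lenIn_eq, inside_eq_self (by simp)]
    rw [huniv, huniv]
    exact hle [] .root fun q _ h => List.suffix_nil.1 h
  · intro p hp hc i hi
    have h1 := hσ3 p hp hc List.nil_suffix i hi
    refine ⟨fun hnot => le_trans (by exact_mod_cast hnum _) (h1.1 hnot), fun hin => ⟨?_, ?_⟩⟩
    · intro x hx hb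
      obtain ⟨e, he, rfl⟩ := P'.mem_edges_iff.1 hx
      exact h1.2 hin e (hpairs e he) hb
    · obtain ⟨hfin, hcard⟩ := hN₂ p hp hc i
      exact le_trans (by exact_mod_cast P'.numEdgesIn_le hfin) hcard

end SplitTree

/-! ### Events of a product space that depend on finitely many coordinates -/

section InfinitePi

variable {ι α : Type*} [Finite α] [MeasurableSpace α] [DiscreteMeasurableSpace α]

theorem measurableSet_of_finset_coordinates (S : Finset ι) {A : Set (ι → α)}
    (hA : ∀ x y : ι → α, (∀ i ∈ S, x i = y i) → x ∈ A → y ∈ A) : MeasurableSet A := by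
  have h : A = S.restrict ⁻¹' (S.restrict '' A) := by
    refine Set.Subset.antisymm (Set.subset_preimage_image _ _) ?_
    rintro y ⟨x, hx, hxy⟩
    exact hA x y (fun i hi => congrFun hxy ⟨i, hi⟩) hx
  rw [h]
  exact S.measurable_restrict (MeasurableSet.of_discrete)

/-- If the coordinates in `S` determine whether `A` holds and which set `B x i` each coordinate
`x i`, `i ∈ T`, is tested for, then the tests succeed with conditional probability at most `c`,
given `A`, as soon as they do for each fixed choice of the coordinates in `S`. -/
theorem infinitePi_dependent_le (μ : ι → Measure α) [∀ i, IsProbabilityMeasure (μ i)]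
    {S T : Finset ι} (hST : Disjoint S T) {A : Set (ι → α)}
    (hA : ∀ x y : ι → α, (∀ i ∈ S, x i = y i) → x ∈ A → y ∈ A)
    {B : (ι → α) → ι → Set α} (hB : ∀ x y : ι → α, (∀ i ∈ S, x i = y i) → B x = B y)
    {c : ENNReal} (hc : ∀ x, ∏ i ∈ T, μ i (B x i) ≤ c) :
    Measure.infinitePi μ {x | x ∈ A ∧ ∀ i ∈ T, x i ∈ B x i} ≤ c * Measure.infinitePi μ A := by
  classical
  rcases isEmpty_or_nonempty (ι → α) with hemp | ⟨⟨x₀⟩⟩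
  · rw [Set.eq_empty_of_isEmpty {x | x ∈ A ∧ ∀ i ∈ T, x i ∈ B x i}]
    simp
  have : Fintype (S → α) := Fintype.ofFinite _
  -- the extension of a choice of the coordinates in `S`
  set ext : (S → α) → ι → α := fun w i => if h : i ∈ S then w ⟨i, h⟩ else x₀ i with hext
  have hext_mem : ∀ w i (h : i ∈ S), ext w i = w ⟨i, h⟩ := fun w i h => dif_pos h
  set W := Finset.univ.filter fun w : S → α => ext w ∈ A with hW
  set box : (S → α) → Set (ι → α) := fun w => (S : Set ι).pi fun i => {ext w i} with hbox
  have hbox_meas : ∀ w, MeasurableSet (box w) := fun w =>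
    MeasurableSet.pi S.countable_toSet fun i _ => MeasurableSet.of_discrete
  have hbox_disj : (W : Set (S → α)).PairwiseDisjoint box := by
    intro w _ w' _ hne
    refine Set.disjoint_left.2 fun x h1 h2 => hne (funext fun ⟨i, hi⟩ => ?_)
    rw [← hext_mem w i hi, ← hext_mem w' i hi]
    exact (h1 i hi).symm.trans (h2 i hi)
  have hbox_sub : (⋃ w ∈ W, box w) ⊆ A := by
    intro x hx
    obtain ⟨w, hw, hxw⟩ := Set.mem_iUnion₂.1 hx
    exact hA (ext w) x (fun i hi => (hxw i hi).symm) (Finset.mem_filter.1 hw).2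
  have hcover : {x | x ∈ A ∧ ∀ i ∈ T, x i ∈ B x i} ⊆ ⋃ w ∈ W,
      ((S ∪ T : Finset ι) : Set ι).pi fun i => if i ∈ S then {ext w i} else B (ext w) i := by
    rintro x ⟨hxA, hxB⟩
    have hx : ∀ i ∈ S, x i = ext (S.restrict x) i := fun i hi =>
      (hext_mem (S.restrict x) i hi).symm
    refine Set.mem_iUnion₂.2 ⟨S.restrict x, Finset.mem_filter.2 ⟨Finset.mem_univ _, hA _ _ hx hxA⟩,
      fun i hi => ?_⟩
    by_cases hiS : i ∈ S
    · simp only [if_pos hiS]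
      exact hx i hiS
    · simp only [if_neg hiS]
      rw [← hB _ _ hx]
      exact hxB i ((Finset.mem_union.1 hi).resolve_left hiS)
  calc _ ≤ Measure.infinitePi μ (⋃ w ∈ W, ((S ∪ T : Finset ι) : Set ι).pi
        fun i => if i ∈ S then {ext w i} else B (ext w) i) := measure_mono hcover
    _ ≤ ∑ w ∈ W, Measure.infinitePi μ (((S ∪ T : Finset ι) : Set ι).pi
        fun i => if i ∈ S then {ext w i} else B (ext w) i) := measure_biUnion_finset_le _ _
    _ ≤ ∑ w ∈ W, c * Measure.infinitePi μ (box w) := by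
        refine Finset.sum_le_sum fun w _ => ?_
        rw [Measure.infinitePi_pi _ fun i _ => MeasurableSet.of_discrete, hbox,
          Measure.infinitePi_pi _ fun i _ => MeasurableSet.of_discrete,
          Finset.prod_union hST, mul_comm]
        refine mul_le_mul' (le_trans (le_of_eq (Finset.prod_congr rfl fun i hi => ?_)) (hc (ext w)))
          (le_of_eq (Finset.prod_congr rfl fun i hi => ?_))
        · rw [if_neg (Finset.disjoint_right.1 hST hi)]
        · rw [if_pos hi]
    _ = c * Measure.infinitePi μ (⋃ w ∈ W, box w) := by
        rw [← Finset.mul_sum, measure_biUnion_finset hbox_disj fun w _ => hbox_meas w]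
    _ ≤ _ := mul_le_mul_right (measure_mono hbox_sub) c

end InfinitePi

/-! ### The probability of good splits -/

theorem Split.finite (V : Type*) [Finite V] : Finite (Split V) :=
  Finite.of_injective (fun π : Split V => (π.parts, π.portals)) fun π π' h => by
    cases π; cases π'
    simpa using h

section Markov

variable {V : Type*} [MetricSpace V] {m β κ₀ : ℝ} {C : Finset V} {ν : PMF (Split V)}

theorem IsRandomSplit.lintegral_bridges_le (hν : IsRandomSplit m β κ₀ C ν) (hκ₀ : 0 ≤ κ₀)
    {L : List (V × V)} (hL : ∀ e ∈ L, e.1 ∈ C ∧ e.2 ∈ C) :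
    ∫⁻ π, ((π.bridges L).length : ENNReal) ∂ν.toMeasure ≤
      ENNReal.ofReal (κ₀ * totalLen L / Metric.diam (C : Set V)) := by
  classical
  induction L with
  | nil => simp [Split.bridges]
  | cons e L ih =>
    have ih := ih fun f hf => hL f (List.mem_cons_of_mem _ hf)
    have heC := hL e List.mem_cons_self
    have h1 : ∀ π : Split V, ((π.bridges (e :: L)).length : ENNReal) =
        {π : Split V | s(e.1, e.2) ∈ π.bridgeEdges}.indicator 1 π +
          ((π.bridges L).length : ENNReal) := by
      intro π
      by_cases hb : s(e.1, e.2) ∈ π.bridgeEdges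
      · simp [Split.bridges, hb, add_comm]
      · simp [Split.bridges, hb]
    simp_rw [h1]
    rw [lintegral_add_left measurable_from_top,
      lintegral_indicator_one MeasurableSpace.measurableSet_top, totalLen_cons, mul_add, add_div,
      ENNReal.ofReal_add (div_nonneg (mul_nonneg hκ₀ dist_nonneg) Metric.diam_nonneg)
        (div_nonneg (mul_nonneg hκ₀ (totalLen_nonneg L)) Metric.diam_nonneg)]
    exact add_le_add (hν.2 e.1 heC.1 e.2 heC.2) ih

/-- Markov's inequality. -/
theorem IsRandomSplit.measure_not_isGood_le (hν : IsRandomSplit m β κ₀ C ν) (hκ₀ : 0 ≤ κ₀)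
    {L : List (V × V)} (hL : ∀ e ∈ L, e.1 ∈ C ∧ e.2 ∈ C) :
    ν.toMeasure {π | ¬ π.IsGood κ₀ C L} ≤ 1 / 2 := by
  have hint := hν.lintegral_bridges_le hκ₀ hL
  set t := κ₀ * totalLen L / Metric.diam (C : Set V) with ht
  have ht0 : 0 ≤ t := div_nonneg (mul_nonneg hκ₀ (totalLen_nonneg L)) Metric.diam_nonneg
  have hmeas : Measurable fun π : Split V => ((π.bridges L).length : ENNReal) :=
    measurable_from_top
  rcases ht0.eq_or_lt with h0 | hpos
  · -- no expected crossings, so almost surely there are none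
    rw [← h0, ENNReal.ofReal_zero, nonpos_iff_eq_zero, lintegral_eq_zero_iff hmeas] at hint
    have hae : ∀ᵐ π ∂ν.toMeasure, ((π.bridges L).length : ENNReal) = 0 := hint
    have hgood : ∀ᵐ π ∂ν.toMeasure, π.IsGood κ₀ C L := by
      filter_upwards [hae] with π hπ
      rw [Split.IsGood, Nat.cast_eq_zero.1 hπ, Nat.cast_zero]
      exact mul_nonneg zero_le_two ht0
    rw [ae_iff.1 hgood]
    exact zero_le
  · have h1 := mul_meas_ge_le_lintegral hmeas (μ := ν.toMeasure) (ENNReal.ofReal (2 * t))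
    have h2 : ν.toMeasure {π | ¬ π.IsGood κ₀ C L} ≤
        ν.toMeasure {π | ENNReal.ofReal (2 * t) ≤ ((π.bridges L).length : ENNReal)} := by
      refine measure_mono fun π hπ => ?_
      simp only [Set.mem_ofPred_eq, Split.IsGood, not_le] at hπ ⊢
      rw [← ENNReal.ofReal_natCast]
      exact ENNReal.ofReal_le_ofReal hπ.le
    have h3 : ENNReal.ofReal (2 * t) * ν.toMeasure {π | ¬ π.IsGood κ₀ C L} ≤ ENNReal.ofReal t :=
      (mul_le_mul_right h2 _).trans (h1.trans hint)
    have ht' : ENNReal.ofReal t ≠ 0 := by simpa using hpos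
    rw [ENNReal.ofReal_mul zero_le_two, mul_comm (ENNReal.ofReal 2), mul_assoc] at h3
    have h4 : ENNReal.ofReal 2 * ν.toMeasure {π | ¬ π.IsGood κ₀ C L} ≤ 1 :=
      (ENNReal.mul_le_mul_iff_right ht' ENNReal.ofReal_ne_top).1 (by rwa [mul_one])
    rw [ENNReal.ofReal_ofNat] at h4
    rw [ENNReal.le_div_iff_mul_le (by simp) (by simp), mul_comm]
    exact h4

end Markov

namespace SplitTree

theorem edgesAt_congr {V : Type*} [MetricSpace V] [DecidableEq V] {γ : ℕ} {β N₁ : ℝ}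
    {E : List (V × V)} {Γ Γ' : SplitTree V γ} {p : Addr V γ}
    (h : ∀ q, q <:+ p → q ≠ p → ∀ i, Γ (q, i) = Γ' (q, i)) :
    edgesAt β N₁ E Γ p = edgesAt β N₁ E Γ' p := by
  induction p with
  | nil => rfl
  | cons x p ih =>
    have hne : ∀ q : Addr V γ, q <:+ p → q ≠ x :: p := fun q hq heq => by
      have := hq.length_le
      rw [heq, List.length_cons] at this
      omega
    simp only [edgesAt]
    rw [ih fun q hq _ => h q (hq.trans (List.suffix_cons _ _)) (hne q hq),
      h p (List.suffix_cons _ _) (hne p (List.suffix_refl _))]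

variable {V : Type*} [Fintype V] {γ : ℕ} {a : ℕ} {m β : ℝ}

theorem ae_isSplitTree [MetricSpace V] {ν : Finset V → PMF (Split V)}
    (hν : ∀ C : Finset V, a < C.card → ∀ π ∈ (ν C).support, π.IsSplitOf m β C) :
    ∀ᵐ Γ ∂law γ ν, Γ.IsSplitTree a m β := by
  have h : ∀ᵐ Γ ∂law γ ν, ∀ x : Addr V γ × Fin γ, Γ x ∈ (ν x.1.cluster).support := by
    refine ae_all_iff.2 fun x => ?_
    have h1 : ∀ᵐ π ∂(ν x.1.cluster).toMeasure, π ∈ (ν x.1.cluster).support := by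
      rw [ae_iff, PMF.toMeasure_apply_eq_zero_iff _ MeasurableSpace.measurableSet_top]
      exact Set.disjoint_left.2 fun _ h2 h3 => h3 h2
    exact (measurePreserving_eval_infinitePi
      (fun x : Addr V γ × Fin γ => (ν x.1.cluster).toMeasure) x).quasiMeasurePreserving.ae h1
  filter_upwards [h] with Γ hΓ p _ hc i
  exact hν p.cluster hc _ (hΓ (p, i))

/-! ### Choosing good splits -/

section Choice

variable [MetricSpace V] [DecidableEq V]

/-- At every node choose a good split, if there is one, for the edges inside the cluster that the
rerouting at the ancestors has produced. -/
noncomputable def goodChoice (β N₁ κ₀ : ℝ) (E : List (V × V)) (Γ : SplitTree V γ) (p : Addr V γ) :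
    Option (Fin γ) :=
  open Classical in
  if h : ∃ i, Split.IsGood κ₀ p.cluster (edgesAt β N₁ E Γ p) (Γ (p, i)) then some h.choose
  else none

variable {N₁ κ₀ : ℝ} {E : List (V × V)} {Γ Γ' : SplitTree V γ}

theorem isGood_of_goodChoice {p : Addr V γ} {i : Fin γ}
    (h : goodChoice β N₁ κ₀ E Γ p = some i) :
    Split.IsGood κ₀ p.cluster (edgesAt β N₁ E Γ p) (Γ (p, i)) := by
  unfold goodChoice at h
  split_ifs at h with hex
  rw [Option.some_inj] at h
  exact h ▸ hex.choose_spec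

theorem goodChoice_congr {p : Addr V γ} (h : ∀ q, q <:+ p → ∀ i, Γ (q, i) = Γ' (q, i)) :
    goodChoice β N₁ κ₀ E Γ p = goodChoice β N₁ κ₀ E Γ' p := by
  have h1 : (fun i => Split.IsGood κ₀ p.cluster (edgesAt β N₁ E Γ p) (Γ (p, i))) =
      fun i => Split.IsGood κ₀ p.cluster (edgesAt β N₁ E Γ' p) (Γ' (p, i)) := by
    funext i
    rw [edgesAt_congr fun q hq _ => h q hq, h p (List.suffix_refl _)]
  have h2 : ∀ Q Q' : Fin γ → Prop, Q = Q' →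
      (open Classical in if h : ∃ i, Q i then some h.choose else none) =
      (open Classical in if h : ∃ i, Q' i then some h.choose else none) := by
    rintro Q _ rfl
    rfl
  exact h2 _ _ h1

theorem isInducedNode_congr {p : Addr V γ}
    (h : ∀ q, q <:+ p → q ≠ p → ∀ i, Γ (q, i) = Γ' (q, i))
    (hp : IsInducedNode a Γ (goodChoice β N₁ κ₀ E Γ) p) :
    IsInducedNode a Γ' (goodChoice β N₁ κ₀ E Γ') p := by
  induction hp with
  | root => exact .root
  | @step p i D hp hc hi hD ih =>
    have h' : ∀ q, q <:+ p → ∀ i, Γ (q, i) = Γ' (q, i) := by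
      intro q hq
      refine h q (hq.trans (List.suffix_cons _ _)) fun heq => ?_
      have := hq.length_le
      rw [heq, List.length_cons] at this
      omega
    refine .step (ih fun q hq _ => h' q hq) hc ?_ ?_
    · rw [← goodChoice_congr h']; exact hi
    · rw [← h' p (List.suffix_refl _)]; exact hD

/-- The non-leaf nodes of the decomposition induced by the good choices. -/
def goodNodes (a : ℕ) (β N₁ κ₀ : ℝ) (E : List (V × V)) (Γ : SplitTree V γ) : Set (Addr V γ) :=
  {p | IsInducedNode a Γ (goodChoice β N₁ κ₀ E Γ) p ∧ a < p.cluster.card}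

end Choice

/-! ### The number of nodes of an induced decomposition -/

section Count

variable [MetricSpace V] {Γ : SplitTree V γ} {Φ : Addr V γ → Option (Fin γ)}

/-- The clusters of one level of the induced decomposition are disjoint. -/
theorem IsInducedNode.eq_of_mem_cluster (hΓ : Γ.IsSplitTree a m β) {p q : Addr V γ}
    (hp : IsInducedNode a Γ Φ p) (hq : IsInducedNode a Γ Φ q) (hlen : p.length = q.length) {u : V}
    (hup : u ∈ p.cluster) (huq : u ∈ q.cluster) : p = q := by
  induction hp generalizing q with
  | root => exact (List.eq_nil_of_length_eq_zero hlen.symm).symm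
  | @step p i D hp hc hi hD ih =>
    cases hq with
    | root => simp at hlen
    | @step q j B hq hc' hj hB =>
      have h1 := hΓ.isSplitOf hp hc i
      have hu1 : u ∈ p.cluster := (h1.1 D hD).2 hup
      have hu2 : u ∈ q.cluster := ((hΓ.isSplitOf hq hc' j).1 B hB).2 huq
      obtain rfl := ih hq (by simpa using hlen) hu1 hu2
      obtain rfl : i = j := Option.some_inj.1 (hi.symm.trans hj)
      rw [h1.unique hD hB hup huq]

theorem IsInducedNode.card_add_length_le (hd : ∀ u v : V, u ≠ v → 1 ≤ dist u v) (ha : 1 ≤ a)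
    (hΓ : Γ.IsSplitTree a m β) {p : Addr V γ} (hp : IsInducedNode a Γ Φ p) :
    p.cluster.card + p.length ≤ Fintype.card V := by
  induction hp with
  | root => simp [Addr.cluster]
  | @step p i D hp hc hi hD ih =>
    have h1 := hΓ.isSplitOf hp hc i
    have h2 := one_le_diam hd (lt_of_le_of_lt ha hc)
    have h3 : D ⊂ p.cluster := by
      refine ((h1.1 D hD).2).ssubset_of_ne fun heq => ?_
      have h4 := h1.2.2.2.1 D hD
      rw [heq] at h4
      linarith
    have h4 : D.card < p.cluster.card := Finset.card_lt_card h3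
    change D.card + (p.length + 1) ≤ _
    omega

theorem encard_nonleaf_le (hd : ∀ u v : V, u ≠ v → 1 ≤ dist u v) (ha : 1 ≤ a)
    (hΓ : Γ.IsSplitTree a m β) :
    {p | IsInducedNode a Γ Φ p ∧ a < p.cluster.card}.encard ≤ ((Fintype.card V) ^ 2 : ℕ) := by
  rcases isEmpty_or_nonempty V with hV | hV
  · rw [Set.eq_empty_of_forall_notMem (s := {p | IsInducedNode a Γ Φ p ∧ a < p.cluster.card})]
    · simp
    · rintro p ⟨-, hp⟩
      simp [Finset.eq_empty_of_isEmpty] at hp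
  have hne : ∀ p : Addr V γ, a < p.cluster.card → ∃ u, u ∈ p.cluster := fun p hp =>
    Finset.card_pos.1 (by omega)
  choose! pt hpt using hne
  have h1 := Set.encard_le_encard_of_injOn (f := fun p : Addr V γ => (pt p, p.length))
    (s := {p | IsInducedNode a Γ Φ p ∧ a < p.cluster.card})
    (t := ((Finset.univ ×ˢ Finset.range (Fintype.card V) : Finset (V × ℕ)) : Set (V × ℕ))) ?_ ?_
  · refine h1.trans (le_of_eq ?_)
    rw [Set.encard_coe_eq_coe_finsetCard, Finset.card_product, Finset.card_range,
      Finset.card_univ, sq]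
  · rintro p ⟨hp, hc⟩
    have := hp.card_add_length_le hd ha hΓ
    simp only [Finset.coe_product, Finset.coe_univ, Finset.coe_range, Set.mem_prod, Set.mem_univ,
      Set.mem_Iio, true_and]
    omega
  · rintro p ⟨hp, hc⟩ q ⟨hq, hc'⟩ heq
    obtain ⟨h2, h3⟩ := Prod.mk.inj heq
    exact hp.eq_of_mem_cluster hΓ hq h3 (hpt p hc) (h2 ▸ hpt q hc')

end Count

/-! ### The probability that a node has no good split -/

section Failure

variable [MetricSpace V] [DecidableEq V] {κ₀ : ℝ} {ν : Finset V → PMF (Split V)}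

theorem measurableSet_goodNodes (a : ℕ) (β N₁ κ₀ : ℝ) (E : List (V × V)) (p : Addr V γ) :
    MeasurableSet {Γ : SplitTree V γ | p ∈ goodNodes a β N₁ κ₀ E Γ} := by
  classical
  have := Split.finite V
  have : DiscreteMeasurableSpace (Split V) := ⟨fun _ => MeasurableSpace.measurableSet_top⟩
  refine measurableSet_of_finset_coordinates (p.tails.toFinset ×ˢ Finset.univ) ?_
  rintro Γ Γ' h ⟨h1, h2⟩
  exact ⟨isInducedNode_congr (fun q hq _ i => h (q, i) (by simpa using hq)) h1, h2⟩

/-- Whether `p` is a node of the induced decomposition, and the edges there, only depend on the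
splits at proper ancestors of `p`; the `γ` splits at `p` are independent of them. -/
theorem law_no_good_split_le (hκ₀ : 0 ≤ κ₀)
    (hν : ∀ C : Finset V, a < C.card → IsRandomSplit m β κ₀ C (ν C)) (N₁ : ℝ) (E : List (V × V))
    (p : Addr V γ) :
    law γ ν {Γ | p ∈ goodNodes a β N₁ κ₀ E Γ ∧
      ∀ i, ¬ Split.IsGood κ₀ p.cluster (edgesAt β N₁ E Γ p) (Γ (p, i))} ≤
      (1 / 2) ^ γ * law γ ν {Γ | p ∈ goodNodes a β N₁ κ₀ E Γ} := by
  classical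
  have := Split.finite V
  have : DiscreteMeasurableSpace (Split V) := ⟨fun _ => MeasurableSpace.measurableSet_top⟩
  by_cases hc : a < p.cluster.card
  swap
  · have h1 : {Γ | p ∈ goodNodes a β N₁ κ₀ E Γ ∧
      ∀ i, ¬ Split.IsGood κ₀ p.cluster (edgesAt β N₁ E Γ p) (Γ (p, i))} = ∅ :=
      Set.eq_empty_of_forall_notMem fun Γ hΓ => hc hΓ.1.2
    rw [h1, measure_empty]
    exact zero_le
  set S : Finset (Addr V γ × Fin γ) := p.tails.toFinset.erase p ×ˢ Finset.univ with hS
  set T : Finset (Addr V γ × Fin γ) := {p} ×ˢ Finset.univ with hT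
  have hST : Disjoint S T := by
    refine Finset.disjoint_left.2 fun x hx hx' => ?_
    simp only [hS, hT, Finset.mem_product, Finset.mem_erase, Finset.mem_singleton] at hx hx'
    exact hx.1.1 hx'.1
  have hagree : ∀ Γ Γ' : SplitTree V γ, (∀ x ∈ S, Γ x = Γ' x) →
      ∀ q, q <:+ p → q ≠ p → ∀ i, Γ (q, i) = Γ' (q, i) := fun Γ Γ' h q hq hne i =>
    h (q, i) (by simp [hS, hq, hne])
  have key := infinitePi_dependent_le
    (μ := fun x : Addr V γ × Fin γ => (ν x.1.cluster).toMeasure) hST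
    (A := {Γ | p ∈ goodNodes a β N₁ κ₀ E Γ})
    (B := fun Γ _ => {π | ¬ Split.IsGood κ₀ p.cluster (edgesAt β N₁ E Γ p) π})
    (c := (1 / 2) ^ γ)
    (fun Γ Γ' h hΓ => ⟨isInducedNode_congr (hagree Γ Γ' h) hΓ.1, hΓ.2⟩)
    (fun Γ Γ' h => by rw [edgesAt_congr (hagree Γ Γ' h)])
    (fun Γ => by
      rw [hT, Finset.prod_product, Finset.prod_singleton]
      refine (Finset.prod_le_pow_card _ _ (1 / 2) fun i _ => ?_).trans (le_of_eq (by simp))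
      exact (hν _ hc).measure_not_isGood_le hκ₀ (edgesAt_subset p))
  refine le_trans (le_of_eq ?_) key
  rw [law]
  congr 1
  ext Γ
  simp [hT]

theorem tsum_law_goodNodes_le (hd : ∀ u v : V, u ≠ v → 1 ≤ dist u v) (ha : 1 ≤ a)
    (hν : ∀ C : Finset V, a < C.card → IsRandomSplit m β κ₀ C (ν C)) (N₁ : ℝ)
    (E : List (V × V)) :
    ∑' p : Addr V γ, law γ ν {Γ | p ∈ goodNodes a β N₁ κ₀ E Γ} ≤
      ((Fintype.card V ^ 2 : ℕ) : ENNReal) := by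
  have : IsProbabilityMeasure (law γ ν) := by unfold law; infer_instance
  have hm := measurableSet_goodNodes (γ := γ) a β N₁ κ₀ E
  calc _ = ∑' p : Addr V γ, ∫⁻ Γ,
          {Γ | p ∈ goodNodes a β N₁ κ₀ E Γ}.indicator 1 Γ ∂law γ ν := by
        simp_rw [lintegral_indicator_one (hm _)]
    _ = ∫⁻ Γ, ∑' p : Addr V γ,
          {Γ | p ∈ goodNodes a β N₁ κ₀ E Γ}.indicator 1 Γ ∂law γ ν :=
        (lintegral_tsum fun p => (measurable_one.indicator (hm p)).aemeasurable).symm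
    _ ≤ ∫⁻ _, ((Fintype.card V ^ 2 : ℕ) : ENNReal) ∂law γ ν := by
        refine lintegral_mono_ae ?_
        filter_upwards [ae_isSplitTree fun C hC => (hν C hC).1] with Γ hΓ
        have h1 : ∑' p : Addr V γ,
            {Γ : SplitTree V γ | p ∈ goodNodes a β N₁ κ₀ E Γ}.indicator
              (1 : SplitTree V γ → ENNReal) Γ =
            ((goodNodes a β N₁ κ₀ E Γ).encard : ENNReal) := by
          rw [← ENNReal.tsum_set_one, tsum_subtype (goodNodes a β N₁ κ₀ E Γ) fun _ => (1 : ENNReal)]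
          rfl
        rw [h1]
        have h2 := encard_nonleaf_le (Φ := goodChoice β N₁ κ₀ E Γ) hd ha hΓ
        exact_mod_cast ENat.toENNReal_le.2 h2
    _ = _ := by simp

/-- Except with probability `n ^ 2 / 2 ^ γ`, every non-leaf of the induced decomposition has a good
split. -/
theorem law_exists_no_good_split_le (hd : ∀ u v : V, u ≠ v → 1 ≤ dist u v) (ha : 1 ≤ a)
    (hκ₀ : 0 ≤ κ₀) (hν : ∀ C : Finset V, a < C.card → IsRandomSplit m β κ₀ C (ν C)) (N₁ : ℝ)
    (E : List (V × V)) :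
    law γ ν {Γ | ¬ (Γ.IsSplitTree a m β ∧ Γ.IsDetermining a (goodChoice β N₁ κ₀ E Γ))} ≤
      (1 / 2) ^ γ * ((Fintype.card V ^ 2 : ℕ) : ENNReal) := by
  have hsub : {Γ | ¬ (Γ.IsSplitTree a m β ∧ Γ.IsDetermining a (goodChoice β N₁ κ₀ E Γ))} ⊆
      {Γ | ¬ Γ.IsSplitTree a m β} ∪ ⋃ p : Addr V γ, {Γ | p ∈ goodNodes a β N₁ κ₀ E Γ ∧
        ∀ i, ¬ Split.IsGood κ₀ p.cluster (edgesAt β N₁ E Γ p) (Γ (p, i))} := by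
    intro Γ hΓ
    by_contra hcon
    simp only [Set.mem_union, Set.mem_ofPred_eq, Set.mem_iUnion, not_or, not_not, not_exists,
      not_and, not_forall] at hcon
    refine hΓ ⟨hcon.1, fun p hp hc => ?_⟩
    have hex := hcon.2 p ⟨hp, hc⟩
    exact ⟨hex.choose, by rw [goodChoice, dif_pos hex]⟩
  have h0 : law γ ν {Γ | ¬ Γ.IsSplitTree a m β} = 0 :=
    ae_iff.1 (ae_isSplitTree fun C hC => (hν C hC).1)
  calc _ ≤ law γ ν {Γ | ¬ Γ.IsSplitTree a m β} + law γ ν (⋃ p : Addr V γ,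
        {Γ | p ∈ goodNodes a β N₁ κ₀ E Γ ∧
          ∀ i, ¬ Split.IsGood κ₀ p.cluster (edgesAt β N₁ E Γ p) (Γ (p, i))}) :=
        (measure_mono hsub).trans (measure_union_le _ _)
    _ ≤ ∑' p : Addr V γ, (1 / 2) ^ γ * law γ ν {Γ | p ∈ goodNodes a β N₁ κ₀ E Γ} := by
        rw [h0, zero_add]
        exact (measure_iUnion_le _).trans
          (ENNReal.tsum_le_tsum fun p => law_no_good_split_le hκ₀ hν N₁ E p)
    _ ≤ _ := by
        rw [ENNReal.tsum_mul_left]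
        exact mul_le_mul_right (tsum_law_goodNodes_le hd ha hν N₁ E) _

end Failure

end SplitTree

/-! ### The constants -/

theorem IsRandomSplit.mono {V : Type*} [MetricSpace V] {m β κ₀ κ₁ : ℝ} (h : κ₀ ≤ κ₁)
    {C : Finset V} {ν : PMF (Split V)} (hν : IsRandomSplit m β κ₀ C ν) :
    IsRandomSplit m β κ₁ C ν :=
  ⟨hν.1, fun u hu v hv => (hν.2 u hu v hv).trans (ENNReal.ofReal_le_ofReal (by
    have := Metric.diam_nonneg (s := (C : Set V))
    gcongr))⟩

theorem one_add_div_pow_le {ε δ : ℝ} (hε : 0 < ε) (hε1 : ε ≤ 1) (hδ : 1 ≤ δ) :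
    (1 + ε / (4 * δ)) ^ (⌊δ⌋₊ + 1) ≤ 1 + ε := by
  have h0 : 0 ≤ ε / (4 * δ) := by positivity
  have h1 : ((⌊δ⌋₊ + 1 : ℕ) : ℝ) ≤ 2 * δ := by
    push_cast
    linarith [Nat.floor_le (zero_le_one.trans hδ)]
  calc (1 + ε / (4 * δ)) ^ (⌊δ⌋₊ + 1) ≤ Real.exp (ε / (4 * δ)) ^ (⌊δ⌋₊ + 1) := by
        gcongr
        linarith [Real.add_one_le_exp (ε / (4 * δ))]
    _ = Real.exp ((⌊δ⌋₊ + 1 : ℕ) * (ε / (4 * δ))) := (Real.exp_nat_mul _ _).symm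
    _ ≤ Real.exp (ε / 2) := by
        gcongr
        calc ((⌊δ⌋₊ + 1 : ℕ) : ℝ) * (ε / (4 * δ)) ≤ 2 * δ * (ε / (4 * δ)) := by gcongr
          _ = ε / 2 := by field_simp; norm_num
    _ ≤ 1 / (1 - ε / 2) := Real.exp_bound_div_one_sub_of_interval (by linarith) (by linarith)
    _ ≤ 1 + ε := by
        rw [div_le_iff₀ (by linarith)]
        nlinarith

theorem half_pow_mul_sq_le {n : ℕ} (hn : 0 < n) :
    (1 / 2 : ENNReal) ^ ⌈3 * Real.logb 2 n⌉₊ * ((n ^ 2 : ℕ) : ENNReal) ≤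
      ENNReal.ofReal (1 / n) := by
  set γ := ⌈3 * Real.logb 2 n⌉₊
  have hn' : (0 : ℝ) < n := by exact_mod_cast hn
  have h1 : (n : ℝ) ^ 3 ≤ 2 ^ γ := by
    have h2 : 3 * Real.logb 2 n ≤ γ := Nat.le_ceil _
    calc (n : ℝ) ^ 3 = (2 ^ Real.logb 2 n) ^ 3 := by
          rw [Real.rpow_logb (by norm_num) (by norm_num) hn']
      _ = 2 ^ (3 * Real.logb 2 n) := by
          rw [← Real.rpow_natCast, ← Real.rpow_mul (by norm_num), mul_comm]
          norm_num
      _ ≤ 2 ^ (γ : ℝ) := Real.rpow_le_rpow_of_exponent_le (by norm_num) h2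
      _ = 2 ^ γ := Real.rpow_natCast _ _
  have h3 : (1 / 2 : ENNReal) = ENNReal.ofReal (1 / 2) := by
    rw [ENNReal.ofReal_div_of_pos (by norm_num)]
    simp
  rw [h3, ← ENNReal.ofReal_pow (by norm_num), ← ENNReal.ofReal_natCast,
    ← ENNReal.ofReal_mul (by positivity)]
  refine ENNReal.ofReal_le_ofReal ?_
  push_cast
  rw [one_div_pow, div_mul_eq_mul_div, one_mul, div_le_div_iff₀ (by positivity) hn']
  linarith [pow_succ (n : ℝ) 2]

theorem theorem7 :
    ∃ b c₁ c₂ : ℝ, 0 < b ∧ 0 < c₁ ∧ c₁ ≤ c₂ ∧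
      ∀ (V : Type*) [Fintype V] [DecidableEq V] [MetricSpace V] (κ Δ δ ε κ₁ κ' β : ℝ) (n γ a : ℕ),
        (∀ u v : V, u ≠ v → 1 ≤ dist u v) →
        Δ = Metric.diam (Set.univ : Set V) → 2 ≤ Δ → δ = Real.logb 2 Δ →
        IsDoublingDim V κ → κ₁ = c₁ * κ → κ' = c₂ * κ →
        0 < ε → ε ≤ 1 → β = ε / (4 * κ₁ * δ) →
        n = Fintype.card V → γ = ⌈3 * Real.logb 2 n⌉₊ → 1 ≤ a →
        ∃ ν : Finset V → PMF (Split V),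
          (∀ C : Finset V, a < C.card → IsRandomSplit (2 ^ (b * κ)) β κ₁ C (ν C)) ∧
          (∀ᵐ Γ ∂SplitTree.law γ ν, Γ.IsSplitTree a (2 ^ (b * κ)) β) ∧
          ∀ (s t : V) (k : ℕ) (P : KWalk V s t), P.IsOptimal k →
            -- the probability of failure, written for the complement of the event
            SplitTree.law γ ν {Γ | ¬ ∃ Φ : Addr V γ → Option (Fin γ), Γ.IsDetermining a Φ ∧
              (∃ P' : KWalk V s t, k ≤ P'.numVisited ∧ P'.len ≤ (1 + ε) * P.len ∧
                Γ.FewEdges a Φ ε (2 * κ' * Real.logb 2 n / ε)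
                  ((16 * κ' * δ / ε) ^ (2 * κ)) P P') ∧
              (∃ P' : KWalk V s t, k ≤ P'.numVisited ∧ P'.len ≤ (1 + ε) * P.len ∧
                Γ.PortalRespecting a Φ ε (2 * κ' * Real.logb 2 n / ε)
                  ((16 * κ' * δ / ε) ^ (2 * κ)) P P')} ≤ ENNReal.ofReal (1 / n) := by
  classical
  -- `36 κ` is the separation constant of the random splits; the factor `4` between `36` and `144`
  -- pays for the factor `2` of Markov's inequality and for the compounding over the levels
  refine ⟨3, 144, 1152, by norm_num, by norm_num, by norm_num, ?_⟩
  intro V _ _ _ κ Δ δ ε κ₁ κ' β n γ a hd hΔ hΔ2 hδ hκ hκ₁ hκ' hε hε1 hβ hn hγ ha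
  have hnt : Nontrivial V := by
    by_contra h
    rw [not_nontrivial_iff_subsingleton] at h
    rw [Metric.diam_subsingleton (Set.subsingleton_of_subsingleton)] at hΔ
    linarith
  have hκ1 : 1 ≤ κ := hκ.one_le
  have hδ1 : 1 ≤ δ := by
    rw [hδ, Real.le_logb_iff_rpow_le (by norm_num) (by linarith), Real.rpow_one]
    exact hΔ2
  have hβ0 : 0 < β := by rw [hβ, hκ₁]; positivity
  have hβ2 : β ≤ 2 := by
    rw [hβ, hκ₁, div_le_iff₀ (by positivity)]
    nlinarith
  have hex : ∀ C : Finset V, ∃ ν : PMF (Split V),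
      a < C.card → IsRandomSplit (2 ^ (3 * κ)) β (36 * κ) C ν := by
    intro C
    by_cases hC : a < C.card
    · obtain ⟨ν, hν⟩ := hκ.exists_isRandomSplit hκ1 hd hβ0.le C (by omega)
      exact ⟨ν, fun _ => hν⟩
    · exact ⟨PMF.pure ⟨∅, fun D => D⟩, fun h => absurd h hC⟩
  choose ν hν using hex
  refine ⟨ν, fun C hC => (hν C hC).mono (by rw [hκ₁]; linarith),
    SplitTree.ae_isSplitTree fun C hC => (hν C hC).1, fun s t k P hP => ?_⟩
  have hN₂ : (2 ^ (3 * κ) * (4 / β) ^ κ) ^ 2 = (16 * κ' * δ / ε) ^ (2 * κ) := by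
    have h1 : (2 : ℝ) ^ (3 * κ) = 8 ^ κ := by
      rw [Real.rpow_mul (by norm_num)]; norm_num
    have h2 : 8 * (4 / β) = 16 * κ' * δ / ε := by
      rw [hβ, hκ₁, hκ']; field_simp; norm_num
    rw [h1, ← Real.mul_rpow (by norm_num) (by positivity), h2, mul_comm 2 κ,
      Real.rpow_mul (by rw [hκ']; positivity), ← Real.rpow_natCast]
    norm_num
  have hdiam : Metric.diam (Set.univ : Set V) < 2 ^ (⌊δ⌋₊ + 1) := by
    rw [← hΔ, ← Real.rpow_natCast, ← Real.logb_lt_iff_lt_rpow (by norm_num) (by linarith), ← hδ]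
    push_cast
    exact Nat.lt_floor_add_one δ
  have hpow : (1 + 4 * β * (36 * κ)) ^ (⌊δ⌋₊ + 1) ≤ 1 + ε := by
    have h1 : 4 * β * (36 * κ) = ε / (4 * δ) := by
      rw [hβ, hκ₁]; field_simp; norm_num
    rw [h1]
    exact one_add_div_pow_le hε hε1 hδ1
  refine le_trans (measure_mono ?_) ((SplitTree.law_exists_no_good_split_le (β := β) hd ha
    (by positivity) hν (2 * κ' * Real.logb 2 n / ε) P.pairs).trans ?_)
  · intro Γ hΓ hcon
    obtain ⟨htree, hdet⟩ := hcon
    have hportal : ∀ p, SplitTree.IsInducedNode a Γ (SplitTree.goodChoice β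
        (2 * κ' * Real.logb 2 n / ε) (36 * κ) P.pairs Γ) p → a < p.cluster.card → ∀ i,
        (Γ (p, i)).portalEdges.Finite ∧
          ((Γ (p, i)).portalEdges.ncard : ℝ) ≤ (16 * κ' * δ / ε) ^ (2 * κ) := by
      intro p hp hc i
      have h1 := hκ.ncard_portalEdges_le hβ0 hβ2 (htree.isSplitOf hp hc i)
      exact ⟨h1.2, hN₂ ▸ h1.1⟩
    have hlen : P.len ≤ (1 + ε) * P.len := by
      rw [P.len_eq]
      nlinarith [totalLen_nonneg P.pairs]
    refine hΓ ⟨_, hdet, ⟨P, hP.1, hlen, ?_⟩, ?_⟩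
    · -- the walk `P` itself: there are few portal-edges altogether
      intro p hp hc i hi
      obtain ⟨hfin, hcard⟩ := hportal p hp hc i
      refine Or.inr ⟨le_trans (by exact_mod_cast P.numEdgesIn_le hfin) hcard, ?_⟩
      rw [P.lenIn_eq]
      nlinarith [totalLen_nonneg (inside p.cluster P.pairs)]
    · obtain ⟨P', h1, h2, h3⟩ := SplitTree.exists_portalRespecting hd ha htree hdet hβ0.le
        (by positivity) P (fun p hp hc i hi => SplitTree.isGood_of_goodChoice hi) hdiam hpow hportal
      exact ⟨P', hP.1.trans h1, h2, h3⟩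
  · rw [← hn, hγ]
    exact half_pow_mul_sq_le (by rw [hn]; exact Fintype.card_pos)
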